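/- Let $\alpha\in\mathbb{C}$ with $|\alpha|\le 1$, and let $\mathcal{M}(\alpha)$ be the set of all harmonic functions $f=h+\overline{g}$ in the unit disk $\mathbb{D}=\{|z|<1\}$, with $h,g$ analytic in $\mathbb{D}$, $h(0)=g(0)=0$, $h'(0)=1$, such that, for all $z\in\mathbb{D}$, $h'(z)\neq 0$, \[ g'(z)=\alpha z h'(z)\quad\text{and}\quad \operatorname{Re}\left(1+\frac{zh''(z)}{h'(z)}\right)>-\frac12 . \] For $0<R\le 1$, a function $f$ is called *fully convex* (respectively *fully starlike*) in the disk $|z|<R$ if it is univalent and sense-preserving (that is, has positive Jacobian) in that disk and, for every $0<r<R$, it maps $|z|<r$ onto a convex domain (respectively onto a domain starlike with respect to the origin) and, for all real $\theta$, \[ \frac{\partial}{\partial\theta}\arg\left\{\frac{\partial}{\partial\theta}f(re^{i\theta})\right\}>0 \qquad\left(\text{respectively}\quad \frac{\partial}{\partial\theta}\arg f(re^{i\theta})>0\right), \] where the curve whose argument is taken does not pass through $0$ and $\arg$ denotes a differentiable determination of the argument along it. Theorem. Let $f\in\mathcal{M}(\alpha)$, $|\alpha|\le 1$. (a) $f$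 maps the disk $|z|<2-\sqrt3$ onto a convex domain, and $f$ is fully convex in $|z|<2-\sqrt3$. (b) $f$ maps the disk $|z|<4\sqrt2-5$ onto a domain that is starlike with respect to the origin, and $f$ is fully starlike in $|z|<4\sqrt2-5$. -/

import Mathlib

open Set Metric
open scoped ComplexConjugate

/-- The class `M(α)`: the harmonic functions `f = h + conj g` of the unit disk, where `h` and `g`
are analytic in the disk with `h(0) = g(0) = 0`, `h'(0) = 1` (that is, `f(0) = 0` and
`f_z(0) = 1`), `g'(z) = α z h'(z)` and `Re (1 + z h''(z) / h'(z)) > -1/2` throughout the disk.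
The quotient presupposes `h'(z) ≠ 0`. Values of `f` outside the disk are irrelevant. -/
def classM (α : ℂ) : Set (ℂ → ℂ) :=
  {f | ∃ h g : ℂ → ℂ,
      DifferentiableOn ℂ h (ball 0 1) ∧ DifferentiableOn ℂ g (ball 0 1) ∧
      h 0 = 0 ∧ g 0 = 0 ∧ deriv h 0 = 1 ∧
      (∀ z ∈ ball (0 : ℂ) 1, f z = h z + conj (g z)) ∧
      (∀ z ∈ ball (0 : ℂ) 1, deriv g z = α * z * deriv h z) ∧
      (∀ z ∈ ball (0 : ℂ) 1, deriv h z ≠ 0 ∧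
        -(1 / 2 : ℝ) < (1 + z * deriv (deriv h) z / deriv h z).re)}

/-- A convex domain of the plane (a convex set is connected). -/
def IsConvexDomain (S : Set ℂ) : Prop :=
  IsOpen S ∧ S.Nonempty ∧ Convex ℝ S

/-- A domain of the plane that is starlike with respect to the origin. -/
def IsStarlikeDomain (S : Set ℂ) : Prop :=
  IsOpen S ∧ (0 : ℂ) ∈ S ∧ StarConvex ℝ 0 S

/-- `f` is univalent and sense-preserving in `|z| < R`: injective, real differentiable and with
positive Jacobian. -/
def UnivalentSensePreserving (f : ℂ → ℂ) (R : ℝ) : Prop :=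
  InjOn f (ball 0 R) ∧
    ∀ z ∈ ball (0 : ℂ) R, DifferentiableAt ℝ f z ∧ 0 < (fderiv ℝ f z).det

/-- `(d/dt) arg γ(t) > 0` for all `t`: the curve `γ` avoids `0` and has a differentiable
determination `φ` of its argument, whose derivative is positive everywhere. -/
def ArgDerivPos (γ : ℝ → ℂ) : Prop :=
  ∃ φ : ℝ → ℝ, Differentiable ℝ φ ∧
    ∀ t : ℝ, γ t ≠ 0 ∧ γ t = (‖γ t‖ : ℂ) * Complex.exp (φ t * Complex.I) ∧ 0 < deriv φ t

/-- The curve `θ ↦ f (r e^{iθ})`. -/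
noncomputable def imageOfCircle (f : ℂ → ℂ) (r : ℝ) : ℝ → ℂ :=
  fun θ => f (r * Complex.exp (θ * Complex.I))

/-- `f` is fully convex (of order `0`) in `|z| < R`: it is univalent and sense-preserving there,
every disk `|z| < r` with `0 < r < R` is mapped onto a convex domain, and
`(∂/∂θ) arg ((∂/∂θ) f (r e^{iθ})) > 0` on every circle `|z| = r`, `0 < r < R`. -/
def FullyConvex (f : ℂ → ℂ) (R : ℝ) : Prop :=
  UnivalentSensePreserving f R ∧
    ∀ r : ℝ, 0 < r → r < R →
      IsConvexDomain (f '' ball 0 r) ∧ ArgDerivPos (deriv (imageOfCircle f r))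

/-- `f` is fully starlike (of order `0`) in `|z| < R`: it is univalent and sense-preserving there,
every disk `|z| < r` with `0 < r < R` is mapped onto a domain starlike with respect to the origin,
and `(∂/∂θ) arg f (r e^{iθ}) > 0` on every circle `|z| = r`, `0 < r < R`. -/
def FullyStarlike (f : ℂ → ℂ) (R : ℝ) : Prop :=
  UnivalentSensePreserving f R ∧
    ∀ r : ℝ, 0 < r → r < R →
      IsStarlikeDomain (f '' ball 0 r) ∧ ArgDerivPos (imageOfCircle f r)

/-! Starlikeness. It is enough to treat the analytic functions K = h + lam g with |lam| ≤ 1, for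
which K' = h'(1 + lam α z). If all of them satisfy Re (z K' conj K) > 0 at a point, an optimisation
over lam (`harmonic_re_pos`) gives |g| < |h| and the corresponding inequality for h + conj g.
Univalence also passes over: f(z₁) = f(z₂) forces K(z₁) = K(z₂) for a suitable lam, and analytic
starlike functions are injective.

To estimate K at a, take the Koebe transform F of K centred at a. Its derivative is (1 - yζ)H(ζ)
with |y| ≤ 1, and H satisfies the same condition Re (ζH'/H) > -3/2 as h'. Since F(-a)/(-a) is a
positive multiple of K(a)/(a K'(a)), what is needed is Re (F(ζ)/ζ) > 0 for |ζ| < 4√2 - 5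
(`re_primitive_div_pos`). Averaging H twice produces M and Q with 2F/ζ = Q + (1 - yζ)M. The model
case is H = (1 - z)⁻³, M = (1 - z)⁻², Q = (1 - z)⁻¹. In general Jack's lemma gives Q = 1/(1 - w)
with w a Schwarz function, and Schwarz–Pick bounds M - Q² by the slack of Q in the disk that
contains its values. The remaining inequality in the plane (`re_pos_of_disk`) reduces to a quadratic
whose discriminant determines the radius 4√2 - 5.

Convexity. Writing zh''/h' = 3u/(1 - u) with |u| ≤ |z| gives Re (1 + zh''/h') ≥ (1 - 2r)/(1 + r).
The tangent to the image of |z| = r then turns monotonically as soon as 1 - 4r + r² > 0, that is,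
for r < 2 - √3.

Geometry. In both cases the curve has an explicit logarithm whose imaginary part increases by 2π per
turn. The boundary of the image lies on this curve. If the argument of the curve is increasing, a
ray from 0 cannot meet the boundary twice; if the argument of the tangent is, there is a supporting
line at every boundary point. -/

/-! ### Jack's lemma -/

theorem hasDerivAt_nonpos_of_right_max {G : ℝ → ℝ} {d : ℝ} (hG : HasDerivAt G d 0)
    (hmax : ∀ s, 0 < s → G s ≤ G 0) : d ≤ 0 := by
  have h := (hasDerivWithinAt_iff_tendsto_slope' (s := Ioi (0 : ℝ)) (by simp)).1
    (hG.hasDerivWithinAt (s := Ioi 0))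
  refine le_of_tendsto h ?_
  filter_upwards [self_mem_nhdsWithin] with s hs
  have hs : 0 < s := hs
  rw [slope_def_field, sub_zero]
  exact div_nonpos_of_nonpos_of_nonneg (by linarith [hmax s hs]) hs.le

/-- The boundary inequality behind Jack's lemma. -/
theorem re_mul_le_of_mapsTo_ball {w : ℂ → ℂ} {z : ℂ} {d : ℂ} (hz : z ≠ 0)
    (hw : DifferentiableOn ℂ w (ball 0 ‖z‖)) (h0 : w 0 = 0)
    (hmaps : MapsTo w (ball 0 ‖z‖) (closedBall 0 1)) (hd : HasDerivAt w d z) (h1 : ‖w z‖ = 1)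
    {e : ℂ} (he : e.re < 0) : (conj (w z) * (d * z) * e).re ≤ e.re := by
  have hzp : 0 < ‖z‖ := norm_pos_iff.2 hz
  -- For every e with Re e < 0 this curve enters the disk. The Schwarz lemma bounds |w| along it by
  -- exp(s Re e), with equality at s = 0, so the derivatives at 0 compare.
  have hcurve : HasDerivAt (fun s : ℝ => z * Complex.exp (s * e)) (z * e) 0 := by
    have h1 : HasDerivAt (fun s : ℝ => (s : ℂ) * e) e 0 := by
      simpa using (Complex.ofRealCLM.hasDerivAt (x := (0 : ℝ))).mul_const e
    have h2 := h1.cexp.const_mul z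
    simpa using h2
  have hwc : HasDerivAt (fun s : ℝ => w (z * Complex.exp (s * e))) (d * (z * e)) 0 := by
    have hd' : HasDerivAt w d (z * Complex.exp (((0 : ℝ) : ℂ) * e)) := by simpa using hd
    exact HasDerivAt.comp (0 : ℝ) hd' hcurve
  have hre := (Complex.reCLM.hasFDerivAt.comp_hasDerivAt (0 : ℝ) (hwc.const_mul (conj (w z))))
  have hexp : HasDerivAt (fun s : ℝ => Real.exp (s * e.re)) e.re 0 := by
    have := ((hasDerivAt_id (0 : ℝ)).mul_const e.re).exp
    simpa using this
  have hG := hre.sub hexp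
  have := hasDerivAt_nonpos_of_right_max hG ?_
  · simp only [Complex.reCLM_apply] at this
    have e1 : conj (w z) * (d * z) * e = conj (w z) * (d * (z * e)) := by ring
    rw [e1]; linarith
  · intro s hs
    have hnorm : ‖Complex.exp (s * e)‖ = Real.exp (s * e.re) := by
      rw [Complex.norm_exp]; simp
    have hlt : Real.exp (s * e.re) < 1 := by
      rw [Real.exp_lt_one_iff]; nlinarith
    have hmem : z * Complex.exp (s * e) ∈ ball (0 : ℂ) ‖z‖ := by
      rw [mem_ball_zero_iff, norm_mul, hnorm]; nlinarith
    have hsch : dist (w (z * Complex.exp (s * e))) (w 0) ≤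
        1 / ‖z‖ * dist (z * Complex.exp (s * e)) 0 := by
      refine Complex.dist_le_div_mul_dist_of_mapsTo_ball hw (by rwa [h0]) hmem
    rw [h0, dist_zero_right, dist_zero_right, norm_mul, hnorm, ← mul_assoc, one_div,
      inv_mul_cancel₀ hzp.ne', one_mul] at hsch
    have hle : (conj (w z) * w (z * Complex.exp (s * e))).re ≤ Real.exp (s * e.re) := by
      refine (Complex.re_le_norm _).trans ?_
      rw [norm_mul, Complex.norm_conj, h1, one_mul]; exact hsch
    have h00 : (conj (w z) * w z).re = 1 := by
      rw [← Complex.normSq_eq_conj_mul_self, Complex.ofReal_re, Complex.normSq_eq_norm_sq, h1]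
      norm_num
    simp only [Pi.sub_apply, Function.comp_apply, Complex.reCLM_apply, Complex.ofReal_zero,
      zero_mul, Complex.exp_zero, mul_one, Real.exp_zero, h00]
    linarith

/-- **Jack's lemma**. -/
theorem jack {w : ℂ → ℂ} (hw : DifferentiableOn ℂ w (ball 0 1)) (h0 : w 0 = 0) :
    (∀ z ∈ ball (0 : ℂ) 1, ‖w z‖ < 1) ∨
      ∃ z ∈ ball (0 : ℂ) 1, ‖w z‖ = 1 ∧ ∃ m : ℝ, 1 ≤ m ∧ z * deriv w z = m * w z := by
  by_cases hall : ∀ z ∈ ball (0 : ℂ) 1, ‖w z‖ < 1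
  · exact Or.inl hall
  right
  push Not at hall
  obtain ⟨z₁, hz₁, hw₁⟩ := hall
  rw [mem_ball_zero_iff] at hz₁
  have hsub : closedBall (0 : ℂ) ‖z₁‖ ⊆ ball 0 1 := closedBall_subset_ball hz₁
  have hcont : ContinuousOn (fun z => ‖w z‖) (closedBall 0 ‖z₁‖) :=
    (hw.continuousOn.mono hsub).norm
  have hcomp : IsCompact (closedBall (0 : ℂ) ‖z₁‖ ∩ (fun z => ‖w z‖) ⁻¹' Ici 1) :=
    (isCompact_closedBall 0 ‖z₁‖).of_isClosed_subset
      (hcont.preimage_isClosed_of_isClosed isClosed_closedBall isClosed_Ici) inter_subset_left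
  -- A point of least modulus with |w| ≥ 1, so that |w| < 1 on the open disk through it.
  obtain ⟨z, ⟨hzc, hzw⟩, hmin⟩ := hcomp.exists_isMinOn
    ⟨z₁, by simp, by simpa using hw₁⟩ continuous_norm.continuousOn
  have hzw : 1 ≤ ‖w z‖ := hzw
  have hz0 : z ≠ 0 := by
    rintro rfl
    rw [h0, norm_zero] at hzw; linarith
  have hzb : z ∈ ball (0 : ℂ) 1 := hsub hzc
  rw [mem_closedBall_zero_iff] at hzc
  have hlt : ∀ y ∈ ball (0 : ℂ) ‖z‖, ‖w y‖ < 1 := by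
    intro y hy
    rw [mem_ball_zero_iff] at hy
    by_contra! hcon
    have := hmin (show y ∈ closedBall (0 : ℂ) ‖z₁‖ ∩ (fun z => ‖w z‖) ⁻¹' Ici 1 from
      ⟨by rw [mem_closedBall_zero_iff]; linarith, hcon⟩)
    exact absurd hy (not_lt.2 this)
  have hdiff : DifferentiableAt ℂ w z := hw.differentiableAt (isOpen_ball.mem_nhds hzb)
  have h1 : ‖w z‖ = 1 := by
    refine le_antisymm ?_ hzw
    have hmem : z ∈ closure (ball (0 : ℂ) ‖z‖) := by
      rw [closure_ball _ (norm_ne_zero_iff.2 hz0)]; simp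
    have := ContinuousWithinAt.closure_le hmem
      (hdiff.continuousAt.norm.continuousWithinAt) continuousWithinAt_const
      (fun y hy => (hlt y hy).le)
    exact this
  refine ⟨z, hzb, h1, ?_⟩
  have key : ∀ e : ℂ, e.re < 0 → (conj (w z) * (deriv w z * z) * e).re ≤ e.re := fun e he =>
    re_mul_le_of_mapsTo_ball hz0
      (hw.mono (ball_subset_ball (mem_ball_zero_iff.1 hzb).le)) h0
      (fun y hy => by rw [mem_closedBall_zero_iff]; exact (hlt y hy).le) hdiff.hasDerivAt h1 he
  set c := conj (w z) * (deriv w z * z) with hc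
  have hcre : 1 ≤ c.re := by
    have := key (-1) (by simp)
    simp at this; linarith
  have hIm : c.im = 0 := by
    by_contra hne
    have hpos : 0 < |c.im| := abs_pos.2 hne
    -- The directions e = -δ ± i give |Im c| ≤ δ(Re c - 1). For this δ the right side is below |Im
    -- c|/2, a contradiction.
    have hε : 0 < |c.im| / (2 * c.re) := by positivity
    have a1 := key ⟨-(|c.im| / (2 * c.re)), 1⟩ (by simpa using hε)
    have a2 := key ⟨-(|c.im| / (2 * c.re)), -1⟩ (by simpa using hε)
    simp only [Complex.mul_re] at a1 a2
    have e1 : |c.im| / (2 * c.re) * c.re = |c.im| / 2 := by field_simp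
    rcases abs_cases c.im with ⟨h, _⟩ | ⟨h, _⟩ <;> nlinarith
  refine ⟨c.re, hcre, ?_⟩
  have hcr : (c.re : ℂ) = c := by
    apply Complex.ext <;> simp [hIm]
  have hww : w z * conj (w z) = 1 := by
    rw [Complex.mul_conj, Complex.normSq_eq_norm_sq, h1]; norm_num
  rw [hcr, hc]
  linear_combination (-(deriv w z * z)) * hww

/-! ### Primitives, logarithms and univalence in a disk -/

theorem exists_primitive {f : ℂ → ℂ} {R : ℝ} (hf : DifferentiableOn ℂ f (ball 0 R)) :
    ∃ F : ℂ → ℂ, F 0 = 0 ∧ ∀ z ∈ ball (0 : ℂ) R, HasDerivAt F (f z) z := by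
  obtain ⟨F, hF⟩ := hf.isExactOn_ball
  exact ⟨fun z => F z - F 0, by simp, fun z hz => (hF z hz).sub_const _⟩

theorem eq_of_hasDerivAt_eq {f g d : ℂ → ℂ} {R : ℝ}
    (hf : ∀ z ∈ ball (0 : ℂ) R, HasDerivAt f (d z) z)
    (hg : ∀ z ∈ ball (0 : ℂ) R, HasDerivAt g (d z) z) (h0 : f 0 = g 0) {z : ℂ}
    (hz : z ∈ ball (0 : ℂ) R) : f z = g z := by
  have hR : 0 < R := pos_of_mem_ball hz
  refine (isOpen_ball.eqOn_of_deriv_eq (convex_ball (0 : ℂ) R).isPreconnected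
    (fun z hz => (hf z hz).differentiableAt.differentiableWithinAt)
    (fun z hz => (hg z hz).differentiableAt.differentiableWithinAt)
    (fun z hz => by rw [(hf z hz).deriv, (hg z hz).deriv]) (mem_ball_self hR) h0) hz

theorem exists_log_of_ne_zero {E : ℂ → ℂ} {R : ℝ} (hR : 0 < R)
    (hE : DifferentiableOn ℂ E (ball 0 R)) (hne : ∀ z ∈ ball (0 : ℂ) R, E z ≠ 0) :
    ∃ L : ℂ → ℂ, DifferentiableOn ℂ L (ball 0 R) ∧
      ∀ z ∈ ball (0 : ℂ) R, E z = Complex.exp (L z) := by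
  obtain ⟨L, hL0, hL⟩ := exists_primitive ((hE.deriv isOpen_ball).div hE hne)
  have hE' : ∀ z ∈ ball (0 : ℂ) R, HasDerivAt E (deriv E z) z := fun z hz =>
    (hE.differentiableAt (isOpen_ball.mem_nhds hz)).hasDerivAt
  have h0 : E 0 ≠ 0 := hne 0 (mem_ball_self hR)
  have hconst : ∀ z ∈ ball (0 : ℂ) R, E z * Complex.exp (-L z) = E 0 := by
    intro z hz
    refine eq_of_hasDerivAt_eq (f := fun z => E z * Complex.exp (-L z)) (g := fun _ => E 0)
      (d := fun _ => 0) (fun z hz => ?_) (fun z hz => hasDerivAt_const _ _) (by simp [hL0]) hz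
    have := (hE' z hz).mul (hL z hz).neg.cexp
    refine this.congr_deriv ?_
    have := hne z hz
    simp only [Pi.div_apply]
    field_simp; ring
  refine ⟨fun z => L z + Complex.log (E 0), fun z hz =>
    ((hL z hz).differentiableAt.add_const _).differentiableWithinAt, fun z hz => ?_⟩
  rw [Complex.exp_add, Complex.exp_log h0, ← hconst z hz, mul_comm (E z), ← mul_assoc,
    ← Complex.exp_add]
  simp

theorem eq_mul_dslope {h : ℂ → ℂ} (h0 : h 0 = 0) (z : ℂ) : h z = z * dslope h 0 z := by
  have := sub_smul_dslope h 0 z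
  simpa [h0] using this.symm

theorem differentiableOn_dslope_ball {h : ℂ → ℂ} {R : ℝ} (hR : 0 < R)
    (hh : DifferentiableOn ℂ h (ball 0 R)) : DifferentiableOn ℂ (dslope h 0) (ball 0 R) :=
  (Complex.differentiableOn_dslope (ball_mem_nhds 0 hR)).2 hh

/-- The **Noshiro–Warschawski theorem**. -/
theorem injOn_of_re_deriv_pos {f f' : ℂ → ℂ} {s : Set ℂ} (hs : Convex ℝ s)
    (hf : ∀ z ∈ s, HasDerivAt f (f' z) z) (hpos : ∀ z ∈ s, 0 < (f' z).re) : InjOn f s := by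
  intro a ha b hb hab
  by_contra hne
  have hmem : ∀ t ∈ Icc (0 : ℝ) 1, a + t * (b - a) ∈ s := fun t ht => by
    have := hs.add_smul_sub_mem ha hb ht
    simpa using this
  have hd : ∀ t ∈ Icc (0 : ℝ) 1, HasDerivAt
      (fun t : ℝ => (conj (b - a) * f (a + t * (b - a))).re)
      ((conj (b - a) * (f' (a + t * (b - a)) * (b - a))).re) t := by
    intro t ht
    have h1 : HasDerivAt (fun t : ℝ => a + (t : ℂ) * (b - a)) (b - a) t := by
      simpa using ((Complex.ofRealCLM.hasDerivAt (x := t)).mul_const (b - a)).const_add a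
    have h2 := HasDerivAt.comp t (hf _ (hmem t ht)) h1
    have h3 := Complex.reCLM.hasFDerivAt.comp_hasDerivAt t (h2.const_mul (conj (b - a)))
    exact h3
  obtain ⟨t, ht, h⟩ := exists_hasDerivAt_eq_zero (f' := fun t : ℝ =>
      (conj (b - a) * (f' (a + t * (b - a)) * (b - a))).re) (zero_lt_one)
    (fun t ht => (hd t ht).continuousAt.continuousWithinAt)
    (by simp [hab]) (fun t ht => hd t (Ioo_subset_Icc_self ht))
  have e : conj (b - a) * (f' (a + t * (b - a)) * (b - a)) =
      (Complex.normSq (b - a) : ℂ) * f' (a + t * (b - a)) := by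
    rw [Complex.normSq_eq_conj_mul_self]; ring
  rw [e, Complex.re_ofReal_mul] at h
  have := hpos _ (hmem t (Ioo_subset_Icc_self ht))
  have h2 : 0 < Complex.normSq (b - a) := Complex.normSq_pos.2 (sub_ne_zero.2 (Ne.symm hne))
  nlinarith

/-! ### Disk automorphisms and Schwarz–Pick -/

theorem norm_sq_sub_norm_sq (p q : ℂ) :
    ‖1 + conj p * q‖ ^ 2 - ‖q + p‖ ^ 2 = (1 - ‖p‖ ^ 2) * (1 - ‖q‖ ^ 2) := by
  simp only [← Complex.normSq_eq_norm_sq, Complex.normSq_apply, Complex.add_re, Complex.add_im,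
    Complex.mul_re, Complex.mul_im, Complex.conj_re, Complex.conj_im, Complex.one_re,
    Complex.one_im]
  ring

theorem one_add_conj_mul_ne_zero {p q : ℂ} (hp : ‖p‖ < 1) (hq : ‖q‖ ≤ 1) :
    1 + conj p * q ≠ 0 := by
  intro h
  have h1 : ‖conj p * q‖ < 1 := by
    rw [norm_mul, Complex.norm_conj]; nlinarith [norm_nonneg p, norm_nonneg q]
  rw [show conj p * q = -1 by linear_combination h] at h1
  simp at h1

theorem norm_moebius_le {p q : ℂ} (hp : ‖p‖ < 1) (hq : ‖q‖ ≤ 1) :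
    ‖(q + p) / (1 + conj p * q)‖ ≤ 1 := by
  rw [norm_div, div_le_one (norm_pos_iff.2 (one_add_conj_mul_ne_zero hp hq))]
  have h2 : 0 ≤ (1 - ‖p‖ ^ 2) * (1 - ‖q‖ ^ 2) := by
    apply mul_nonneg <;> nlinarith [norm_nonneg p, norm_nonneg q]
  exact abs_le_of_sq_le_sq' (by linarith [norm_sq_sub_norm_sq p q]) (norm_nonneg _) |>.2

theorem norm_moebius_lt {p q : ℂ} (hp : ‖p‖ < 1) (hq : ‖q‖ < 1) :
    ‖(q + p) / (1 + conj p * q)‖ < 1 := by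
  rw [norm_div, div_lt_one (norm_pos_iff.2 (one_add_conj_mul_ne_zero hp hq.le))]
  have h2 : 0 < (1 - ‖p‖ ^ 2) * (1 - ‖q‖ ^ 2) := by
    apply mul_pos <;> nlinarith [norm_nonneg p, norm_nonneg q]
  exact lt_of_pow_lt_pow_left₀ 2 (norm_nonneg _) (by linarith [norm_sq_sub_norm_sq p q])

theorem hasDerivAt_moebius {a ζ : ℂ} (ha : ‖a‖ < 1) (hζ : ‖ζ‖ < 1) :
    HasDerivAt (fun ζ => (ζ + a) / (1 + conj a * ζ))
      ((1 * (1 + conj a * ζ) - (ζ + a) * (conj a * 1)) / (1 + conj a * ζ) ^ 2) ζ :=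
  ((hasDerivAt_id' ζ).add_const a).div (((hasDerivAt_id' ζ).const_mul (conj a)).const_add 1)
    (one_add_conj_mul_ne_zero ha hζ.le)

theorem schwarz_pick_deriv_of_lt {v : ℂ → ℂ} (hv : DifferentiableOn ℂ v (ball 0 1))
    (hlt : ∀ z ∈ ball (0 : ℂ) 1, ‖v z‖ < 1) {a : ℂ} (ha : ‖a‖ < 1) :
    ‖deriv v a‖ * (1 - ‖a‖ ^ 2) ≤ 1 - ‖v a‖ ^ 2 := by
  have hva := hlt a (by simpa using ha)
  set b := v a with hb
  have hφm : ∀ ζ ∈ ball (0 : ℂ) 1, (ζ + a) / (1 + conj a * ζ) ∈ ball (0 : ℂ) 1 := fun ζ hζ => by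
    simpa using norm_moebius_lt ha (by simpa using hζ)
  have hvd : ∀ ζ ∈ ball (0 : ℂ) 1, HasDerivAt v (deriv v ζ) ζ := fun ζ hζ =>
    (hv.differentiableAt (isOpen_ball.mem_nhds hζ)).hasDerivAt
  -- Conjugating v by automorphisms that move a and v(a) to 0 reduces the claim to the Schwarz lemma
  -- at the origin.
  set G : ℂ → ℂ := fun ζ => (v ((ζ + a) / (1 + conj a * ζ)) + -b) /
    (1 + conj (-b) * v ((ζ + a) / (1 + conj a * ζ))) with hG
  have hnb : ‖-b‖ < 1 := by simpa using hva
  have hGd : ∀ ζ ∈ ball (0 : ℂ) 1, HasDerivAt G _ ζ := fun ζ hζ =>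
    (((hvd _ (hφm ζ hζ)).comp ζ (hasDerivAt_moebius ha (mem_ball_zero_iff.1 hζ))).add_const (-b)).div
      ((((hvd _ (hφm ζ hζ)).comp ζ (hasDerivAt_moebius ha (mem_ball_zero_iff.1 hζ))).const_mul (conj (-b))).const_add 1)
      (one_add_conj_mul_ne_zero hnb (hlt _ (hφm ζ hζ)).le)
  have hG0 : G 0 = 0 := by simp [hG, ← hb]
  have hle := Complex.norm_deriv_le_one_of_mapsTo_ball (f := G) (c := 0) (R := 1)
    (fun ζ hζ => (hGd ζ hζ).differentiableAt.differentiableWithinAt)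
    (fun ζ hζ => by
      rw [hG0, mem_closedBall_zero_iff]
      exact (norm_moebius_lt hnb (hlt _ (hφm ζ hζ))).le) one_pos
  rw [(hGd 0 (by simp)).deriv] at hle
  have hbb : (1 - ‖b‖ ^ 2 : ℂ) ≠ 0 := by
    have : (0 : ℝ) < 1 - ‖b‖ ^ 2 := by nlinarith [norm_nonneg b]
    exact_mod_cast this.ne'
  have haa : a * conj a = (‖a‖ ^ 2 : ℂ) := Complex.mul_conj' a
  have hbb' : conj b * b = (‖b‖ ^ 2 : ℂ) := Complex.conj_mul' b
  simp only [zero_add, mul_zero, add_zero, div_one, Function.comp_apply, ← hb, one_pow, mul_one,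
    add_neg_cancel, zero_mul, sub_zero, map_neg] at hle
  rw [haa, show (1 : ℂ) + -conj b * b = 1 - ‖b‖ ^ 2 by rw [neg_mul, hbb', sub_eq_add_neg],
    pow_two (1 - (‖b‖ ^ 2 : ℂ)), mul_div_mul_right _ _ hbb, norm_div, norm_mul] at hle
  have e1 : ‖(1 - ‖a‖ ^ 2 : ℂ)‖ = 1 - ‖a‖ ^ 2 := by
    have : (0 : ℝ) ≤ 1 - ‖a‖ ^ 2 := by nlinarith [norm_nonneg a]
    rw [← Complex.norm_of_nonneg this]; push_cast; rfl
  have hp : (0 : ℝ) < 1 - ‖b‖ ^ 2 := by nlinarith [norm_nonneg b]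
  have e2 : ‖(1 - ‖b‖ ^ 2 : ℂ)‖ = 1 - ‖b‖ ^ 2 := by
    rw [← Complex.norm_of_nonneg hp.le]; push_cast; rfl
  rw [e1, e2, div_le_one hp] at hle
  exact hle

/-- The infinitesimal **Schwarz–Pick lemma**. -/
theorem schwarz_pick_deriv {v : ℂ → ℂ} (hv : DifferentiableOn ℂ v (ball 0 1))
    (hle : ∀ z ∈ ball (0 : ℂ) 1, ‖v z‖ ≤ 1) {a : ℂ} (ha : ‖a‖ < 1) :
    ‖deriv v a‖ * (1 - ‖a‖ ^ 2) ≤ 1 - ‖v a‖ ^ 2 := by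
  -- Scaling by s < 1 makes the bound on v strict; then s → 1.
  have hs : ∀ s ∈ Ioo (0 : ℝ) 1,
      s * ‖deriv v a‖ * (1 - ‖a‖ ^ 2) ≤ 1 - s ^ 2 * ‖v a‖ ^ 2 := by
    intro s hs
    have := schwarz_pick_deriv_of_lt (v := fun z => (s : ℂ) * v z) (hv.const_mul _)
      (fun z hz => by
        rw [norm_mul, Complex.norm_of_nonneg hs.1.le]
        have := hle z hz
        nlinarith [hs.1, hs.2]) ha
    rw [deriv_const_mul _ (hv.differentiableAt (isOpen_ball.mem_nhds (by simpa using ha))),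
      norm_mul, norm_mul, Complex.norm_of_nonneg hs.1.le, mul_pow] at this
    exact this
  have h1 : (1 : ℝ) ∈ closure (Ioo (0 : ℝ) 1) := by
    rw [closure_Ioo zero_ne_one]; simp
  have := ContinuousWithinAt.closure_le (f := fun s : ℝ => s * ‖deriv v a‖ * (1 - ‖a‖ ^ 2))
    (g := fun s : ℝ => 1 - s ^ 2 * ‖v a‖ ^ 2) h1
    (by fun_prop) (by fun_prop) hs
  simpa using this

/-! ### Averaging operators and subordination -/

/-- The map w ↦ w/(1 - w) takes the unit disk to the half-plane Re > -1/2 and the unit circle to its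
edge. All conditions on z H'/H are read through it. -/
theorem re_div_one_sub {w : ℂ} (hw : w ≠ 1) :
    (w / (1 - w)).re = -(1 / 2) + (1 - ‖w‖ ^ 2) / (2 * ‖1 - w‖ ^ 2) := by
  have h : 0 < Complex.normSq (1 - w) := Complex.normSq_pos.2 (sub_ne_zero.2 hw.symm)
  rw [Complex.div_re, ← Complex.normSq_eq_norm_sq, ← Complex.normSq_eq_norm_sq]
  field_simp
  simp only [Complex.normSq_apply, Complex.sub_re, Complex.sub_im, Complex.one_re, Complex.one_im]
  ring

theorem ne_one_of_norm_lt_one {w : ℂ} (hw : ‖w‖ < 1) : w ≠ 1 := by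
  rintro rfl; simp at hw

theorem re_div_one_sub_of_lt {w : ℂ} (hw : ‖w‖ < 1) : -(1 / 2) < (w / (1 - w)).re := by
  have h1 := ne_one_of_norm_lt_one hw
  rw [re_div_one_sub h1]
  have h2 : 0 < ‖1 - w‖ := norm_pos_iff.2 (sub_ne_zero.2 h1.symm)
  have h3 : 0 < 1 - ‖w‖ ^ 2 := by nlinarith [norm_nonneg w]
  have : 0 < (1 - ‖w‖ ^ 2) / (2 * ‖1 - w‖ ^ 2) := by positivity
  linarith

theorem re_div_one_sub_of_eq {w : ℂ} (hw : ‖w‖ = 1) (h1 : w ≠ 1) : (w / (1 - w)).re = -(1 / 2) := by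
  rw [re_div_one_sub h1, hw]; simp

/-- The order of starlikeness type condition is preserved, with improved order, by the
transformation `H ↦ M`, `n M + z M' = n H`. -/
theorem bernardi_order {n : ℝ} (hn : 0 < n) {H M : ℂ → ℂ} (hH : DifferentiableOn ℂ H (ball 0 1))
    (hM : DifferentiableOn ℂ M (ball 0 1)) (hne : ∀ z ∈ ball (0 : ℂ) 1, H z ≠ 0)
    (hre : ∀ z ∈ ball (0 : ℂ) 1, -((n + 1) / 2) < (z * deriv H z / H z).re)
    (hrel : ∀ z ∈ ball (0 : ℂ) 1, n * M z + z * deriv M z = n * H z) :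
    ∀ z ∈ ball (0 : ℂ) 1, M z ≠ 0 ∧ -(n / 2) < (z * deriv M z / M z).re := by
  have hnC : (n : ℂ) ≠ 0 := by exact_mod_cast hn.ne'
  -- Chosen so that M = H(1 - w) and zM'/M = n w/(1 - w); the claim becomes |w| < 1.
  set w : ℂ → ℂ := fun z => z * deriv M z / (n * H z) with hw
  have hwd : DifferentiableOn ℂ w (ball 0 1) :=
    (differentiableOn_id.mul (hM.deriv isOpen_ball)).div (hH.const_mul _)
      (fun z hz => mul_ne_zero hnC (hne z hz))
  have hw1 : ∀ z ∈ ball (0 : ℂ) 1, z * deriv M z = n * H z * w z := fun z hz => by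
    have := hne z hz
    simp only [hw]; field_simp
  have hMw : ∀ z ∈ ball (0 : ℂ) 1, M z = H z * (1 - w z) := fun z hz =>
    mul_left_cancel₀ hnC (by linear_combination hrel z hz - hw1 z hz)
  have hder : ∀ z ∈ ball (0 : ℂ) 1,
      deriv M z = deriv H z * (1 - w z) - H z * deriv w z := fun z hz => by
    have hnhds := isOpen_ball.mem_nhds hz
    have h1 := ((hH.differentiableAt hnhds).hasDerivAt.mul
      ((hwd.differentiableAt hnhds).hasDerivAt.const_sub 1))
    have h2 : M =ᶠ[nhds z] H * fun z => 1 - w z := by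
      filter_upwards [hnhds] with y hy using hMw y hy
    rw [h2.deriv_eq, h1.deriv]; ring
  rcases jack hwd (by simp [hw]) with hlt | ⟨z, hz, hz1, m, hm, hmz⟩
  · intro z hz
    have h1 := sub_ne_zero.2 (ne_one_of_norm_lt_one (hlt z hz)).symm
    have hHz := hne z hz
    refine ⟨by rw [hMw z hz]; exact mul_ne_zero hHz h1, ?_⟩
    have : z * deriv M z / M z = (n : ℂ) * (w z / (1 - w z)) := by
      rw [hw1 z hz, hMw z hz]; field_simp
    rw [this, Complex.re_ofReal_mul]
    nlinarith [re_div_one_sub_of_lt (hlt z hz)]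
  · exfalso
    have hHz := hne z hz
    have e : (n + m) * w z * H z = (1 - w z) * (z * deriv H z) := by
      have := hw1 z hz
      rw [hder z hz] at this
      linear_combination (-1 : ℂ) * this - H z * hmz
    have hw0 : w z ≠ 0 := by rw [← norm_pos_iff, hz1]; exact one_pos
    have hnm : (n + m : ℂ) ≠ 0 := by
      have : (0 : ℝ) < n + m := by linarith
      exact_mod_cast this.ne'
    have hne1 : w z ≠ 1 := fun h => by
      rw [h, sub_self, zero_mul, mul_one] at e
      exact mul_ne_zero hnm hHz e
    have h1 := sub_ne_zero.2 hne1.symm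
    -- At a Jack point zH'/H lies on the line Re = -(n + m)/2. As m ≥ 1, this violates the
    -- hypothesis on H.
    have e2 : z * deriv H z / H z = ((n + m : ℝ) : ℂ) * (w z / (1 - w z)) := by
      push_cast; field_simp; linear_combination -e
    have := hre z hz
    rw [e2, Complex.re_ofReal_mul, re_div_one_sub_of_eq hz1 hne1] at this
    linarith

/-- Marx–Strohhäcker: `Re (z Q' / Q) > -1/2` forces `Q` to be subordinate to `1 / (1 - z)`. -/
theorem norm_one_sub_inv_lt {Q : ℂ → ℂ} (hQ : DifferentiableOn ℂ Q (ball 0 1)) (h0 : Q 0 = 1)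
    (hne : ∀ z ∈ ball (0 : ℂ) 1, Q z ≠ 0)
    (hre : ∀ z ∈ ball (0 : ℂ) 1, -(1 / 2) < (z * deriv Q z / Q z).re) :
    ∀ z ∈ ball (0 : ℂ) 1, ‖1 - (Q z)⁻¹‖ < 1 := by
  have hd : ∀ z ∈ ball (0 : ℂ) 1, HasDerivAt (fun z => 1 - (Q z)⁻¹) (deriv Q z / Q z ^ 2) z :=
    fun z hz => by
    have := ((hQ.differentiableAt (isOpen_ball.mem_nhds hz)).hasDerivAt.inv (hne z hz)).const_sub 1
    exact this.congr_deriv (by ring)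
  rcases jack (w := fun z => 1 - (Q z)⁻¹)
    (fun z hz => (hd z hz).differentiableAt.differentiableWithinAt) (by simp [h0]) with
    h | ⟨z, hz, hz1, m, hm, hmz⟩
  · exact h
  · exfalso
    have hQz := hne z hz
    rw [(hd z hz).deriv] at hmz
    have hne1 : 1 - (Q z)⁻¹ ≠ 1 := by simpa using hQz
    -- With w = 1 - 1/Q one has zQ'/Q = zw'/(1 - w), and zw' = mw at the Jack point.
    have e : z * deriv Q z / Q z = (m : ℂ) * ((1 - (Q z)⁻¹) / (1 - (1 - (Q z)⁻¹))) := by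
      rw [sub_sub_cancel, mul_div_assoc', ← hmz]
      field_simp
    have := hre z hz
    rw [e, Complex.re_ofReal_mul, re_div_one_sub_of_eq hz1 hne1] at this
    linarith

theorem exists_add_mul_deriv_eq {H : ℂ → ℂ} (hH : DifferentiableOn ℂ H (ball 0 1)) :
    ∃ Q : ℂ → ℂ, DifferentiableOn ℂ Q (ball 0 1) ∧
      ∀ z ∈ ball (0 : ℂ) 1, Q z + z * deriv Q z = H z := by
  obtain ⟨A, hA0, hA⟩ := exists_primitive hH
  have hQ := differentiableOn_dslope_ball one_pos
    (fun z hz => (hA z hz).differentiableAt.differentiableWithinAt)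
  refine ⟨dslope A 0, hQ, fun z hz => ?_⟩
  have h1 := (hasDerivAt_id' z).mul (hQ.differentiableAt (isOpen_ball.mem_nhds hz)).hasDerivAt
  have h2 : ((fun z : ℂ => z) * dslope A 0) = A := funext fun z => (eq_mul_dslope hA0 z).symm
  rw [h2] at h1
  rw [(hA z hz).unique h1]; ring

/-- The equation says (z²M)' = 2zH. Solving A + zA' = 2zH first and then dividing A by z keeps
everything analytic. -/
theorem exists_two_mul_add_mul_deriv_eq {H : ℂ → ℂ} (hH : DifferentiableOn ℂ H (ball 0 1)) :
    ∃ M : ℂ → ℂ, DifferentiableOn ℂ M (ball 0 1) ∧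
      ∀ z ∈ ball (0 : ℂ) 1, 2 * M z + z * deriv M z = 2 * H z := by
  obtain ⟨A, hA, hAH⟩ := exists_add_mul_deriv_eq
    (H := fun z => 2 * (z * H z)) ((differentiableOn_id.mul hH).const_mul 2)
  have hA0 : A 0 = 0 := by simpa using hAH 0 (by simp)
  have hM := differentiableOn_dslope_ball one_pos hA
  have hd : ∀ z ∈ ball (0 : ℂ) 1, HasDerivAt A (dslope A 0 z + z * deriv (dslope A 0) z) z :=
    fun z hz => by
    have h1 := (hasDerivAt_id' z).mul (hM.differentiableAt (isOpen_ball.mem_nhds hz)).hasDerivAt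
    have h2 : ((fun z : ℂ => z) * dslope A 0) = A := funext fun z => (eq_mul_dslope hA0 z).symm
    rw [h2] at h1
    exact h1.congr_deriv (by ring)
  refine ⟨dslope A 0, hM, fun z hz => ?_⟩
  -- At 0 division by z is not available. Differentiating A + zA' = 2zH there gives 2A'(0) = 2H(0).
  rcases eq_or_ne z 0 with rfl | hz0
  · have hnhds := isOpen_ball.mem_nhds hz
    have hev : (fun z => A z + z * deriv A z) =ᶠ[nhds 0] fun z => 2 * (z * H z) := by
      filter_upwards [hnhds] with y hy using hAH y hy
    have h1 := (hA.differentiableAt hnhds).hasDerivAt.add ((hasDerivAt_id' (0 : ℂ)).mul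
      ((hA.deriv isOpen_ball).differentiableAt hnhds).hasDerivAt)
    have h2 := ((hasDerivAt_id' (0 : ℂ)).mul (hH.differentiableAt hnhds).hasDerivAt).const_mul 2
    have h3 := h1.unique (h2.congr_of_eventuallyEq hev)
    rw [dslope_same]
    linear_combination h3
  · have := hAH z hz
    rw [(hd z hz).deriv, eq_mul_dslope hA0 z] at this
    refine mul_left_cancel₀ hz0 ?_
    linear_combination this

/-! ### The planar inequality behind the radius 4√2 - 5 -/

/-- The quadratic in a has negative discriminant exactly when (1 + r)² < 8(1 - r), i.e. r² + 10r - 7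
< 0; the positive root is 4√2 - 5. -/
theorem half_re_pos_aux {r a : ℝ} (hr0 : 0 ≤ r) (hr : r < 4 * Real.sqrt 2 - 5) :
    0 < 2 * a ^ 2 - a * ((1 + r) / (1 - r)) + 1 / (1 - r) := by
  have h2 : Real.sqrt 2 ^ 2 = 2 := Real.sq_sqrt (by norm_num)
  have hs := Real.sqrt_nonneg 2
  have hs1 : Real.sqrt 2 < 3 / 2 := by nlinarith
  have h1 : 0 < 1 - r := by linarith
  have hq : r ^ 2 + 10 * r - 7 < 0 := by nlinarith
  have e : 2 * a ^ 2 - a * ((1 + r) / (1 - r)) + 1 / (1 - r) =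
      2 * (a - (1 + r) / (4 * (1 - r))) ^ 2 + (8 * (1 - r) - (1 + r) ^ 2) / (8 * (1 - r) ^ 2) := by
    field_simp; ring
  rw [e]
  have : 0 < (8 * (1 - r) - (1 + r) ^ 2) / (8 * (1 - r) ^ 2) := by
    apply div_pos <;> nlinarith
  positivity

/-- The circle case: `t` on the circle which is the image of `|w| = r` under `1 / (1 - w)`. -/
theorem re_pos_of_circle {r : ℝ} (hr0 : 0 ≤ r) (hr : r < 4 * Real.sqrt 2 - 5) {t x : ℂ}
    (hx : ‖x‖ ≤ r) (ht : (1 - r ^ 2) * ‖t‖ ^ 2 = 2 * t.re - 1) :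
    0 < (t + (1 - x) * t ^ 2).re := by
  have h2 : Real.sqrt 2 ^ 2 = 2 := Real.sq_sqrt (by norm_num)
  have hs := Real.sqrt_nonneg 2
  have h1 : 0 < 1 - r := by nlinarith
  have hlow : -(r * ‖t‖ ^ 2) ≤ (-x * t ^ 2).re := by
    have h3 : ‖-x * t ^ 2‖ ≤ r * ‖t‖ ^ 2 := by
      rw [norm_mul, norm_neg, norm_pow]; gcongr
    have h4 := Complex.abs_re_le_norm (-x * t ^ 2)
    have := neg_abs_le (-x * t ^ 2).re
    linarith
  have key := half_re_pos_aux (a := t.re) hr0 hr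
  have hN : ‖t‖ ^ 2 = t.re ^ 2 + t.im ^ 2 := by
    rw [← Complex.normSq_eq_norm_sq, Complex.normSq_apply]; ring
  have e : (t + (1 - x) * t ^ 2).re = t.re + (t.re ^ 2 - t.im ^ 2) + (-x * t ^ 2).re := by
    have : t + (1 - x) * t ^ 2 = t + t ^ 2 + -x * t ^ 2 := by ring
    rw [this, Complex.add_re, Complex.add_re, pow_two t, Complex.mul_re]; ring
  rw [e]
  have key2 : 0 < (1 - r) * (2 * t.re ^ 2 - t.re * ((1 + r) / (1 - r)) + 1 / (1 - r)) :=
    mul_pos h1 key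
  have e2 : (1 - r) * (2 * t.re ^ 2 - t.re * ((1 + r) / (1 - r)) + 1 / (1 - r)) =
      (1 - r) * (2 * t.re ^ 2) - t.re * (1 + r) + 1 := by field_simp
  rw [e2] at key2
  have e3 : (1 - r) * (t.re + (t.re ^ 2 - t.im ^ 2) - r * ‖t‖ ^ 2) =
      (1 - r) * (2 * t.re ^ 2) - t.re * (1 + r) + 1 := by
    rw [hN] at ht ⊢
    linear_combination (-1 : ℝ) * ht
  have : 0 < t.re + (t.re ^ 2 - t.im ^ 2) - r * ‖t‖ ^ 2 := by
    by_contra! hcon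
    have := mul_nonpos_of_nonneg_of_nonpos h1.le hcon
    linarith
  linarith

theorem pos_of_affine {A B m y : ℝ} (hy : y ^ 2 ≤ m ^ 2) (h1 : 0 < A + B * m)
    (h2 : 0 < A + B * (-m)) : 0 < A + B * y := by
  have h3 : |y| ≤ |m| := sq_le_sq.1 hy
  have h4 : |B * y| ≤ |B * m| := by rw [abs_mul, abs_mul]; gcongr
  have h5 : |B * m| < A := abs_lt.2 ⟨by linarith, by linarith⟩
  have := neg_abs_le (B * y)
  linarith

/-- The bound on ε is the slack of t in the disk bounded by the circle of `re_pos_of_circle`. After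
a rotation and scaling by e with e² = 1 - x, the worst-case loss from ε cancels the term -(Im u)²
coming from Re u². The lower bound is then affine in Im u, so it suffices to check the two ends of a
chord, which lie on the circle, where the allowed ε is 0. -/
theorem re_pos_of_disk {r : ℝ} (hr0 : 0 ≤ r) (hr : r < 4 * Real.sqrt 2 - 5) {t x ε : ℂ}
    (hx : ‖x‖ ≤ r)
    (hε : (1 - r ^ 2) * ‖ε‖ ≤ 2 * t.re - 1 - (1 - r ^ 2) * ‖t‖ ^ 2) :
    0 < (t + (1 - x) * (t ^ 2 + ε)).re := by
  have h2 : Real.sqrt 2 ^ 2 = 2 := Real.sq_sqrt (by norm_num)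
  have hs := Real.sqrt_nonneg 2
  have h1 : 0 < 1 - r := by nlinarith
  have hr2 : 0 < 1 - r ^ 2 := by nlinarith
  obtain ⟨e, he⟩ := IsAlgClosed.exists_pow_nat_eq (1 - x) (n := 2) two_pos
  have he0 : e ≠ 0 := by
    rintro rfl
    have : x = 1 := by linear_combination he
    rw [this, norm_one] at hx; linarith
  -- The centre of the disk; its squared radius is c² - c = (rc)², named `ρ2` below.
  set c : ℝ := 1 / (1 - r ^ 2) with hc
  have hc1 : (1 - r ^ 2) * c = 1 := by rw [hc]; field_simp
  set u : ℂ := e * (t - c) with hu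
  have htu : t = c + u / e := by rw [hu]; field_simp; ring
  set q := ‖e‖ ^ 2 with hq
  have hqpos : 0 < q := by have := norm_pos_iff.2 he0; positivity
  have hq' : q = e.re ^ 2 + e.im ^ 2 := by
    rw [hq, ← Complex.normSq_eq_norm_sq, Complex.normSq_apply]; ring
  set ρ2 : ℝ := c ^ 2 - c with hρ
  have htc : ∀ s : ℂ, ‖s‖ ^ 2 = s.re ^ 2 + s.im ^ 2 := fun s => by
    rw [← Complex.normSq_eq_norm_sq, Complex.normSq_apply]; ring
  have hucirc : ‖u‖ ^ 2 = q * (‖t‖ ^ 2 - 2 * c * t.re + c ^ 2) := by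
    rw [hu, norm_mul, mul_pow, htc (t - c), htc t, Complex.sub_re, Complex.sub_im,
      Complex.ofReal_re, Complex.ofReal_im, ← hq]
    ring
  have hinv : ∀ v : ℂ, v / e = ((v.re * e.re + v.im * e.im) / q : ℝ) +
      ((v.im * e.re - v.re * e.im) / q : ℝ) * Complex.I := fun v => by
    apply Complex.ext
    · rw [Complex.div_re, Complex.normSq_eq_norm_sq, ← hq]; simp; ring
    · rw [Complex.div_im, Complex.normSq_eq_norm_sq, ← hq]; simp; ring
  set A : ℝ := c + u.re * e.re / q + (e.re ^ 2 - e.im ^ 2) * c ^ 2 + 2 * c * (u.re * e.re) +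
    2 * u.re ^ 2 - q * ρ2 with hA
  set B : ℝ := e.im / q - 2 * c * e.im with hB
  -- Re u is frozen and Im u replaced by Y. The bracket on the right is the slack, zero on the
  -- circle and at least q‖ε‖ at the given point.
  have hval : ∀ Y : ℝ, (((c : ℂ) + (⟨u.re, Y⟩ : ℂ) / e) +
      (1 - x) * ((c : ℂ) + (⟨u.re, Y⟩ : ℂ) / e) ^ 2).re =
      A + B * Y + (q * ρ2 - u.re ^ 2 - Y ^ 2) := by
    intro Y
    have e1 : (1 - x) * ((c : ℂ) + (⟨u.re, Y⟩ : ℂ) / e) ^ 2 =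
        e ^ 2 * (c : ℂ) ^ 2 + 2 * c * (e * ⟨u.re, Y⟩) + (⟨u.re, Y⟩ : ℂ) ^ 2 := by
      rw [← he]; field_simp; ring
    rw [e1, Complex.add_re, Complex.add_re, hinv]
    simp only [pow_two, Complex.add_re, Complex.mul_re, Complex.mul_im, Complex.ofReal_re,
      Complex.ofReal_im, Complex.I_re, Complex.I_im, Complex.re_ofNat, Complex.im_ofNat]
    rw [hA, hB]; ring
  have hcirc : ∀ Y : ℝ, u.re ^ 2 + Y ^ 2 = q * ρ2 → 0 < A + B * Y := by
    intro Y hY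
    have := re_pos_of_circle hr0 hr hx (t := (c : ℂ) + (⟨u.re, Y⟩ : ℂ) / e) ?_
    · rw [hval] at this; linarith
    · rw [hinv, htc]
      simp only [Complex.add_re, Complex.add_im, Complex.mul_re, Complex.mul_im, Complex.ofReal_re,
        Complex.ofReal_im, Complex.I_re, Complex.I_im]
      have e2 : ((u.re * e.re + Y * e.im) / q) ^ 2 + ((Y * e.re - u.re * e.im) / q) ^ 2 = ρ2 := by
        have : (u.re * e.re + Y * e.im) ^ 2 + (Y * e.re - u.re * e.im) ^ 2 = q * (q * ρ2) := by
          rw [← hY, hq']; ring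
        field_simp; linarith
      linear_combination (1 - r ^ 2) * e2 + (1 - r ^ 2) * hρ +
        (2 * ((u.re * e.re + Y * e.im) / q) + 2 * c - 1) * hc1
  have hle : ‖u‖ ^ 2 + q * ‖ε‖ ≤ q * ρ2 := by
    rw [hucirc]
    have : (1 - r ^ 2) * (‖t‖ ^ 2 - 2 * c * t.re + c ^ 2 + ‖ε‖) ≤ (1 - r ^ 2) * ρ2 := by
      rw [hρ]
      have e3 : (1 - r ^ 2) * (‖t‖ ^ 2 - 2 * c * t.re + c ^ 2 + ‖ε‖) =
        (1 - r ^ 2) * ‖t‖ ^ 2 - 2 * t.re + (1 - r ^ 2) * c ^ 2 + (1 - r ^ 2) * ‖ε‖ := by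
        linear_combination (-2 * t.re) * hc1
      rw [e3]; nlinarith
    have := le_of_mul_le_mul_left this hr2
    nlinarith
  have hε0 := norm_nonneg ε
  have hre2 : u.re ^ 2 + u.im ^ 2 = ‖u‖ ^ 2 := (htc u).symm
  have hm : 0 ≤ q * ρ2 - u.re ^ 2 := by nlinarith [sq_nonneg u.im]
  have hsq := Real.sq_sqrt hm
  have hpos : 0 < A + B * u.im :=
    pos_of_affine (m := Real.sqrt (q * ρ2 - u.re ^ 2)) (by rw [hsq]; nlinarith)
      (hcirc _ (by rw [hsq]; ring)) (hcirc _ (by rw [neg_sq, hsq]; ring))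
  have hfin := hval u.im
  have hueta : (⟨u.re, u.im⟩ : ℂ) = u := rfl
  rw [hueta, ← htu] at hfin
  have hεlow : -(q * ‖ε‖) ≤ ((1 - x) * ε).re := by
    have h3 : ‖(1 - x) * ε‖ = q * ‖ε‖ := by rw [norm_mul, ← he, norm_pow]
    have h4 := Complex.abs_re_le_norm ((1 - x) * ε)
    have := neg_abs_le ((1 - x) * ε).re
    linarith
  have : t + (1 - x) * (t ^ 2 + ε) = (t + (1 - x) * t ^ 2) + (1 - x) * ε := by ring
  rw [this, Complex.add_re, hfin]
  linarith

/-- Here F(ζ) = ζ(Q + (1 - yζ)M)/2 for the two successive averages M, Q of H. With Q = 1/(1 - w) and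
w = ζv, the relation M = Q + ζQ' becomes M = Q²(1 + ζ²v'). This is the form required by
`re_pos_of_disk` with t = Q and ε = Q²ζ²v'. -/
theorem re_primitive_div_pos {H F : ℂ → ℂ} {y ζ : ℂ} (hH : DifferentiableOn ℂ H (ball 0 1))
    (hne : ∀ z ∈ ball (0 : ℂ) 1, H z ≠ 0) (hH0 : H 0 = 1)
    (hre : ∀ z ∈ ball (0 : ℂ) 1, -(3 / 2) < (z * deriv H z / H z).re) (hy : ‖y‖ ≤ 1)
    (hF0 : F 0 = 0) (hF : ∀ z ∈ ball (0 : ℂ) 1, HasDerivAt F ((1 - y * z) * H z) z)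
    (hζ0 : ζ ≠ 0) (hζ : ‖ζ‖ < 4 * Real.sqrt 2 - 5) : 0 < (F ζ / ζ).re := by
  have hs2 : Real.sqrt 2 ^ 2 = 2 := Real.sq_sqrt (by norm_num)
  have hs := Real.sqrt_nonneg 2
  have hζ1 : ‖ζ‖ < 1 := by nlinarith
  have hζb : ζ ∈ ball (0 : ℂ) 1 := by simpa using hζ1
  obtain ⟨M, hM, hMH⟩ := exists_two_mul_add_mul_deriv_eq hH
  obtain ⟨Q, hQ, hQM⟩ := exists_add_mul_deriv_eq hM
  have hM1 := bernardi_order (n := 2) two_pos hH hM hne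
    (fun z hz => by have := hre z hz; norm_num; linarith)
    (fun z hz => by exact_mod_cast hMH z hz)
  have hQ1 := bernardi_order (n := 1) one_pos hM hQ (fun z hz => (hM1 z hz).1)
    (fun z hz => by have := (hM1 z hz).2; norm_num at this ⊢; linarith)
    (fun z hz => by simpa using hQM z hz)
  have hM0 : M 0 = 1 := by have := hMH 0 (by simp); rw [hH0] at this; simpa using this
  have hQ0 : Q 0 = 1 := by simpa [hM0] using hQM 0 (by simp)
  have hQne : ∀ z ∈ ball (0 : ℂ) 1, Q z ≠ 0 := fun z hz => (hQ1 z hz).1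
  have hw := norm_one_sub_inv_lt hQ hQ0 hQne (fun z hz => (hQ1 z hz).2)
  have hMd : ∀ z ∈ ball (0 : ℂ) 1, HasDerivAt M (deriv M z) z := fun z hz =>
    (hM.differentiableAt (isOpen_ball.mem_nhds hz)).hasDerivAt
  have hQd : ∀ z ∈ ball (0 : ℂ) 1, HasDerivAt Q (deriv Q z) z := fun z hz =>
    (hQ.differentiableAt (isOpen_ball.mem_nhds hz)).hasDerivAt
  have hFeq : F ζ = 1 / 2 * (ζ * (Q ζ + (1 - y * ζ) * M ζ)) := by
    refine eq_of_hasDerivAt_eq (g := fun ζ => 1 / 2 * (ζ * (Q ζ + (1 - y * ζ) * M ζ)))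
      hF (fun z hz => ?_) (by simp [hF0]) hζb
    have := ((hasDerivAt_id' z).mul ((hQd z hz).add
      ((((hasDerivAt_id' z).const_mul y).const_sub 1).mul (hMd z hz)))).const_mul (1 / 2 : ℂ)
    refine this.congr_deriv ?_
    simp only [Pi.add_apply, Pi.mul_apply]
    linear_combination (1 / 2 : ℂ) * hQM z hz + (1 / 2 : ℂ) * (1 - y * z) * hMH z hz
  set w : ℂ → ℂ := fun z => 1 - (Q z)⁻¹ with hwdef
  have hwd : DifferentiableOn ℂ w (ball 0 1) := (hQ.inv hQne).const_sub 1
  have hw0 : w 0 = 0 := by simp [hwdef, hQ0]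
  set v := dslope w 0 with hv
  have hvd : DifferentiableOn ℂ v (ball 0 1) := differentiableOn_dslope_ball one_pos hwd
  have hv1 : ∀ z ∈ ball (0 : ℂ) 1, ‖v z‖ ≤ 1 := fun z hz => by
    have := Complex.norm_dslope_le_div_of_mapsTo_ball (R₂ := 1) hwd
      (fun z hz => by rw [hw0, mem_closedBall_zero_iff]; exact (hw z hz).le) hz
    simpa using this
  have hpick := schwarz_pick_deriv hvd hv1 hζ1
  have hwv : ∀ z, w z = z * v z := eq_mul_dslope hw0
  have hwder : deriv w ζ = v ζ + ζ * deriv v ζ := by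
    have h1 := (hasDerivAt_id' ζ).mul
      (hvd.differentiableAt (isOpen_ball.mem_nhds hζb)).hasDerivAt
    have h2 : ((fun z : ℂ => z) * v) = w := funext fun z => (hwv z).symm
    rw [h2] at h1
    rw [h1.deriv]; ring
  have hwder2 : deriv w ζ = deriv Q ζ / Q ζ ^ 2 := by
    have := ((hQd ζ hζb).inv (hQne ζ hζb)).const_sub 1
    rw [show w = fun z => 1 - (Q⁻¹) z from rfl, this.deriv]; ring
  have hQζ := hQne ζ hζb
  have hwQ : (1 - w ζ) * Q ζ = 1 := by simp only [hwdef]; field_simp; ring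
  have hMeq : M ζ = Q ζ ^ 2 + Q ζ ^ 2 * ζ ^ 2 * deriv v ζ := by
    have h3 : deriv Q ζ = Q ζ ^ 2 * (v ζ + ζ * deriv v ζ) := by
      rw [← hwder, hwder2]; field_simp
    rw [← hQM ζ hζb, h3]
    have h4 := hwv ζ
    linear_combination (-Q ζ) * hwQ - Q ζ ^ 2 * h4
  have hgoal : F ζ / ζ = ((1 / 2 : ℝ) : ℂ) *
      (Q ζ + (1 - y * ζ) * (Q ζ ^ 2 + Q ζ ^ 2 * ζ ^ 2 * deriv v ζ)) := by
    rw [hFeq, hMeq]; push_cast; field_simp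
  rw [hgoal, Complex.re_ofReal_mul]
  have hnw : ‖Q ζ‖ ^ 2 * ‖w ζ‖ ^ 2 = ‖Q ζ‖ ^ 2 - 2 * (Q ζ).re + 1 := by
    have h5 : Q ζ * w ζ = Q ζ - 1 := by linear_combination -hwQ
    rw [← mul_pow, ← norm_mul, h5, ← Complex.normSq_eq_norm_sq, ← Complex.normSq_eq_norm_sq,
      Complex.normSq_apply, Complex.normSq_apply]
    simp; ring
  have hnw2 : ‖w ζ‖ ^ 2 = ‖ζ‖ ^ 2 * ‖v ζ‖ ^ 2 := by rw [hwv, norm_mul, mul_pow]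
  have hvle := hv1 ζ hζb
  have hvle2 : ‖v ζ‖ ^ 2 ≤ 1 := by nlinarith [norm_nonneg (v ζ)]
  have hX : 0 ≤ ‖Q ζ‖ ^ 2 * ‖ζ‖ ^ 2 := by positivity
  -- Schwarz–Pick for v gives (1 - |ζ|²)|ε| ≤ |Q|²(|ζ|² - |w|²). By Qw = Q - 1, the right side is
  -- the slack of Q in the disk.
  have := re_pos_of_disk (r := ‖ζ‖) (t := Q ζ) (x := y * ζ)
    (ε := Q ζ ^ 2 * ζ ^ 2 * deriv v ζ) (norm_nonneg _) hζ
    (by rw [norm_mul]; nlinarith [norm_nonneg ζ])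
    (by
      rw [norm_mul, norm_mul, norm_pow, norm_pow]
      rw [hnw2] at hnw
      have := mul_le_mul_of_nonneg_left hpick hX
      nlinarith)
  linarith

/-! ### The Koebe transform -/

/-- For N = zh''/h', the condition Re N > -3/2 makes u = N/(3 + N) bounded by 1. Since u(0) = 0, the
Schwarz lemma gives u = zk with |k| ≤ 1, and N = 3u/(1 - u). The relation is stated without z so
that it can be transported by automorphisms. -/
theorem exists_schwarz_factor {h : ℂ → ℂ} (hh : DifferentiableOn ℂ h (ball 0 1))
    (hne : ∀ z ∈ ball (0 : ℂ) 1, deriv h z ≠ 0)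
    (hre : ∀ z ∈ ball (0 : ℂ) 1, -(3 / 2) < (z * deriv (deriv h) z / deriv h z).re) :
    ∃ k : ℂ → ℂ, ∀ z ∈ ball (0 : ℂ) 1, ‖k z‖ ≤ 1 ∧
      deriv (deriv h) z * (1 - k z * z) = 3 * k z * deriv h z := by
  have h1 := hh.deriv isOpen_ball
  have h2 := h1.deriv isOpen_ball
  have hden : ∀ z ∈ ball (0 : ℂ) 1, 3 * deriv h z + z * deriv (deriv h) z ≠ 0 := by
    intro z hz h0
    have h3 := hre z hz
    have h4 := hne z hz
    have : z * deriv (deriv h) z / deriv h z = -3 := by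
      field_simp; linear_combination h0
    rw [this] at h3
    norm_num at h3
  set k : ℂ → ℂ := fun z => deriv (deriv h) z / (3 * deriv h z + z * deriv (deriv h) z) with hk
  have hkd : DifferentiableOn ℂ k (ball 0 1) :=
    h2.div ((h1.const_mul 3).add (differentiableOn_id.mul h2)) hden
  set u : ℂ → ℂ := fun z => z * k z with hu
  have hud : DifferentiableOn ℂ u (ball 0 1) := differentiableOn_id.mul hkd
  have hu0 : u 0 = 0 := by simp [hu]
  have hult : ∀ z ∈ ball (0 : ℂ) 1, ‖u z‖ ≤ 1 := by
    intro z hz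
    have h3 := hre z hz
    have h4 := hne z hz
    set N := z * deriv (deriv h) z / deriv h z with hN
    have e : u z = N / (3 + N) := by
      have := hden z hz
      have h5 : 3 + N ≠ 0 := fun h0 => this (by
        have : 3 * deriv h z + z * deriv (deriv h) z = deriv h z * (3 + N) := by
          rw [hN]; field_simp
        rw [this, h0, mul_zero])
      simp only [hu, hk]
      have h6 : z * deriv (deriv h) z = N * deriv h z := by rw [hN]; field_simp
      rw [mul_div_assoc', h6]; field_simp
    rw [e, norm_div]
    refine div_le_one_of_le₀ ?_ (norm_nonneg _)
    refine abs_le_of_sq_le_sq' ?_ (norm_nonneg _) |>.2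
    rw [← Complex.normSq_eq_norm_sq, ← Complex.normSq_eq_norm_sq, Complex.normSq_apply,
      Complex.normSq_apply]
    simp only [Complex.add_re, Complex.add_im, Complex.re_ofNat, Complex.im_ofNat]
    nlinarith
  have hkeq : ∀ z ∈ ball (0 : ℂ) 1, dslope u 0 z = k z := by
    intro z hz
    rcases eq_or_ne z 0 with rfl | hz0
    · rw [dslope_same]
      have := (hasDerivAt_id' (0 : ℂ)).mul
        (hkd.differentiableAt (isOpen_ball.mem_nhds hz)).hasDerivAt
      rw [show u = (fun z => z) * k from rfl, this.deriv]; simp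
    · have := eq_mul_dslope hu0 z
      exact (mul_left_cancel₀ hz0 this).symm
  refine ⟨k, fun z hz => ⟨?_, ?_⟩⟩
  · have := Complex.norm_dslope_le_div_of_mapsTo_ball (R₂ := 1) hud
      (fun z hz => by rw [hu0, mem_closedBall_zero_iff]; exact hult z hz) hz
    rw [hkeq z hz] at this
    simpa using this
  · have : k z * (3 * deriv h z + z * deriv (deriv h) z) = deriv (deriv h) z :=
      div_mul_cancel₀ _ (hden z hz)
    linear_combination -this

/-- The starlikeness estimate for the functions with derivative `h' (1 + ω z)`, obtained from
`re_primitive_div_pos` through the Koebe transform. -/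
theorem re_mul_conj_pos_of_koebe {h K : ℂ → ℂ} {ω a : ℂ} (hh : DifferentiableOn ℂ h (ball 0 1))
    (hne : ∀ z ∈ ball (0 : ℂ) 1, deriv h z ≠ 0)
    (hre : ∀ z ∈ ball (0 : ℂ) 1, -(3 / 2) < (z * deriv (deriv h) z / deriv h z).re)
    (hω : ‖ω‖ ≤ 1) (hK0 : K 0 = 0)
    (hK : ∀ z ∈ ball (0 : ℂ) 1, HasDerivAt K (deriv h z * (1 + ω * z)) z)
    (ha0 : a ≠ 0) (ha : ‖a‖ < 4 * Real.sqrt 2 - 5) :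
    0 < (a * (deriv h a * (1 + ω * a)) * conj (K a)).re := by
  have hs2 : Real.sqrt 2 ^ 2 = 2 := Real.sq_sqrt (by norm_num)
  have hs := Real.sqrt_nonneg 2
  have ha1 : ‖a‖ < 1 := by nlinarith
  obtain ⟨k, hk⟩ := exists_schwarz_factor hh hne hre
  have hab : a ∈ ball (0 : ℂ) 1 := by simpa using ha1
  have hca : ‖conj a‖ < 1 := by rwa [Complex.norm_conj]
  have hmem : ∀ ζ ∈ ball (0 : ℂ) 1, (ζ + a) / (1 + conj a * ζ) ∈ ball (0 : ℂ) 1 := fun ζ hζ => by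
    simpa using norm_moebius_lt ha1 (mem_ball_zero_iff.1 hζ)
  have hd0 : ∀ ζ ∈ ball (0 : ℂ) 1, 1 + conj a * ζ ≠ 0 := fun ζ hζ =>
    one_add_conj_mul_ne_zero ha1 (mem_ball_zero_iff.1 hζ).le
  have hc0 := hne a hab
  have hωa : 1 + ω * a ≠ 0 := by
    have := one_add_conj_mul_ne_zero hca hω
    rwa [Complex.conj_conj, mul_comm] at this
  set m : ℝ := 1 - ‖a‖ ^ 2 with hm
  have hmpos : 0 < m := by rw [hm]; nlinarith [norm_nonneg a]
  have hmC : (m : ℂ) = 1 - a * conj a := by rw [hm, Complex.mul_conj']; push_cast; ring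
  have hmC0 : (m : ℂ) ≠ 0 := by exact_mod_cast hmpos.ne'
  -- The cube collects two powers from the derivative of the automorphism and one from the
  -- denominator of 1 + ω(ζ + a)/(1 + conj a ζ). It also matches the factor 3 in zh''/h' = 3zk/(1 -
  -- zk), so that H keeps the order -3/2.
  set H : ℂ → ℂ := fun ζ => deriv h ((ζ + a) / (1 + conj a * ζ)) /
    (deriv h a * (1 + conj a * ζ) ^ 3) with hH
  have hHd : ∀ ζ ∈ ball (0 : ℂ) 1, HasDerivAt H _ ζ := fun ζ hζ =>
    ((((hh.deriv isOpen_ball).differentiableAt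
      (isOpen_ball.mem_nhds (hmem ζ hζ))).hasDerivAt.comp ζ
      (hasDerivAt_moebius ha1 (mem_ball_zero_iff.1 hζ)))).div
      (((((hasDerivAt_id' ζ).const_mul (conj a)).const_add 1).pow 3).const_mul (deriv h a))
      (mul_ne_zero hc0 (pow_ne_zero 3 (hd0 ζ hζ)))
  have hHne : ∀ ζ ∈ ball (0 : ℂ) 1, H ζ ≠ 0 := fun ζ hζ =>
    div_ne_zero (hne _ (hmem ζ hζ)) (mul_ne_zero hc0 (pow_ne_zero 3 (hd0 ζ hζ)))
  have hHre : ∀ ζ ∈ ball (0 : ℂ) 1, -(3 / 2) < (ζ * deriv H ζ / H ζ).re := by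
    intro ζ hζ
    have hd := hd0 ζ hζ
    obtain ⟨hk1, hk2⟩ := hk _ (hmem ζ hζ)
    have hHd' := (hHd ζ hζ).deriv
    have hh1 := hne _ (hmem ζ hζ)
    simp only [Function.comp_apply, Pi.pow_apply] at hHd'
    have hwd : (ζ + a) / (1 + conj a * ζ) * (1 + conj a * ζ) = ζ + a := div_mul_cancel₀ _ hd
    have hHval : H ζ = deriv h ((ζ + a) / (1 + conj a * ζ)) /
      (deriv h a * (1 + conj a * ζ) ^ 3) := rfl
    set w := (ζ + a) / (1 + conj a * ζ) with hw
    set d := 1 + conj a * ζ with hdd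
    have hS : 1 - k w * a ≠ 0 := by
      have := one_add_conj_mul_ne_zero (p := -conj a) (by simpa using ha1) hk1
      simp only [map_neg, Complex.conj_conj] at this
      intro h0; exact this (by linear_combination h0)
    -- The transformed Schwarz factor: ζH'/H = 3ζκ/(1 - ζκ) with |κ| ≤ 1.
    set κ := (k w - conj a) / (1 - k w * a) with hκ
    have hκ1 : ‖κ‖ ≤ 1 := by
      have := norm_moebius_le (p := -conj a) (by simpa using ha1) hk1
      simp only [map_neg, Complex.conj_conj] at this
      rw [hκ]; convert this using 3 <;> ring
    have hκS : κ * (1 - k w * a) = k w - conj a := by rw [hκ]; field_simp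
    have hu : ‖ζ * κ‖ < 1 := by
      rw [norm_mul]
      have := mem_ball_zero_iff.1 hζ
      nlinarith [norm_nonneg ζ, norm_nonneg κ]
    have hu1 := sub_ne_zero.2 (ne_one_of_norm_lt_one hu).symm
    have key : deriv H ζ * (1 - ζ * κ) = 3 * κ * H ζ := by
      rw [hHd', hHval]
      have hkey : (deriv (deriv h) w * (1 - a * conj a) - 3 * conj a * d * deriv h w) *
          ((1 - ζ * κ) * (1 - k w * a)) = 3 * (κ * (1 - k w * a)) * deriv h w * d ^ 2 := by
        have e1 : (1 - ζ * κ) * (1 - k w * a) = (1 - k w * w) * d := by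
          linear_combination (-ζ) * hκS + k w * hwd + hdd
        have e2 : (1 - k w * w) * d = (1 - k w * a) - ζ * (k w - conj a) := by
          linear_combination (-k w) * hwd + hdd
        rw [e1, hκS]
        linear_combination (1 - a * conj a) * d * hk2 - 3 * conj a * d * deriv h w * e2 -
          3 * (k w - conj a) * d * deriv h w * hdd
      have hkey2 := mul_right_cancel₀ hS (show ((deriv (deriv h) w * (1 - a * conj a) -
        3 * conj a * d * deriv h w) * (1 - ζ * κ)) * (1 - k w * a) =
        (3 * κ * deriv h w * d ^ 2) * (1 - k w * a) by linear_combination hkey)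
      have e3 : (1 * d - (ζ + a) * (conj a * 1)) = 1 - a * conj a := by
        rw [hdd]; ring
      rw [e3]
      clear_value κ d w
      generalize deriv h w = p at *
      generalize deriv (deriv h) w = p2 at *
      push_cast
      field_simp
      linear_combination hkey2
    have e : ζ * deriv H ζ / H ζ = ((3 : ℝ) : ℂ) * ((ζ * κ) / (1 - ζ * κ)) := by
      have := hHne ζ hζ
      push_cast
      field_simp
      linear_combination ζ * key
    rw [e, Complex.re_ofReal_mul]
    linarith [re_div_one_sub_of_lt hu]
  -- Up to the factor 1 + ωa and the denominator absorbed in H, the linear factor 1 + ω(·) becomes 1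
  -- - yζ.
  set y : ℂ := -((ω + conj a) / (1 + ω * a)) with hy
  have hy1 : ‖y‖ ≤ 1 := by
    have := norm_moebius_le hca hω
    rw [Complex.conj_conj, mul_comm a] at this
    rw [hy, norm_neg]; exact this
  set F : ℂ → ℂ := fun ζ => (K ((ζ + a) / (1 + conj a * ζ)) - K a) /
    (m * (deriv h a * (1 + ω * a))) with hF
  have hFd : ∀ ζ ∈ ball (0 : ℂ) 1, HasDerivAt F ((1 - y * ζ) * H ζ) ζ := by
    intro ζ hζ
    have hd := hd0 ζ hζ
    have := (((hK _ (hmem ζ hζ)).comp ζ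
      (hasDerivAt_moebius ha1 (mem_ball_zero_iff.1 hζ))).sub_const (K a)).div_const
      (m * (deriv h a * (1 + ω * a)))
    refine this.congr_deriv ?_
    have e3 : 1 * (1 + conj a * ζ) - (ζ + a) * (conj a * 1) = m := by
      rw [hmC]; ring
    rw [e3]
    simp only [hH, hy]
    generalize deriv h ((ζ + a) / (1 + conj a * ζ)) = p
    generalize hde : 1 + conj a * ζ = d at hd ⊢
    field_simp
    linear_combination -p * hde
  have hF0 : F 0 = 0 := by simp [hF]
  have hna : -a ≠ 0 := neg_ne_zero.2 ha0
  -- The automorphism sends -a to 0, where K vanishes, so F(-a) involves only K(a).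
  have := re_primitive_div_pos (ζ := -a)
    (fun ζ hζ => (hHd ζ hζ).differentiableAt.differentiableWithinAt) hHne
    (by simp [hH, hc0]) hHre hy1 hF0 hFd hna (by rwa [norm_neg])
  have hFa : F (-a) / -a = ((1 / m : ℝ) : ℂ) * (K a / (a * (deriv h a * (1 + ω * a)))) := by
    simp only [hF, neg_add_cancel, zero_div, hK0]
    push_cast
    field_simp
    ring
  rw [hFa, Complex.re_ofReal_mul] at this
  have hp : 0 < (K a / (a * (deriv h a * (1 + ω * a)))).re :=
    pos_of_mul_pos_right this (by positivity)
  set D := a * (deriv h a * (1 + ω * a)) with hD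
  have hD0 : D ≠ 0 := mul_ne_zero ha0 (mul_ne_zero hc0 hωa)
  have hKD : K a = K a / D * D := by field_simp
  have e4 : D * conj (K a) = (Complex.normSq D : ℂ) * conj (K a / D) := by
    conv_lhs => rw [hKD]
    rw [map_mul, ← Complex.mul_conj]; ring
  rw [e4, Complex.re_ofReal_mul, Complex.conj_re]
  exact mul_pos (Complex.normSq_pos.2 hD0) hp

/-! ### From analytic combinations to the harmonic map; univalence -/

/-- Starlikeness of all the combinations `a + lam b`, `|lam| ≤ 1`, passes to the harmonic
combination `a + conj b`. -/
theorem harmonic_re_pos {a b A B : ℂ}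
    (h : ∀ lam : ℂ, ‖lam‖ ≤ 1 → 0 < ((A + lam * B) * conj (a + lam * b)).re) :
    ‖b‖ < ‖a‖ ∧ 0 < ((A - conj B) * conj (a + conj b)).re := by
  constructor
  · by_contra! hcon
    rcases eq_or_ne b 0 with rfl | hb
    · have ha : a = 0 := by simpa using hcon
      have := h 0 (by simp)
      simp [ha] at this
    -- If |b| ≥ |a|, this choice of lam annihilates a + lam b.
    · have := h (-(a / b)) (by
        rw [norm_neg, norm_div]; exact div_le_one_of_le₀ hcon (norm_nonneg _))
      have e : a + -(a / b) * b = 0 := by field_simp; ring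
      rw [e] at this
      simp at this
  set X := (A * conj a).re with hX
  set Y := (B * conj b).re with hY
  set U := B * conj a + conj A * b with hU
  set V := A * b - B * a with hV
  have hUV : ‖U‖ ^ 2 = ‖V‖ ^ 2 + 4 * (X * Y) := by
    simp only [hU, hV, hX, hY, ← Complex.normSq_eq_norm_sq, Complex.normSq_apply, Complex.add_re,
      Complex.add_im, Complex.sub_re, Complex.sub_im, Complex.mul_re, Complex.mul_im,
      Complex.conj_re, Complex.conj_im]
    ring
  -- The hypothesis with lam = -sμ, the phase μ chosen to make the cross term as negative as
  -- possible.
  have hs : ∀ s : ℝ, 0 ≤ s → s ≤ 1 → s * ‖U‖ < X + s ^ 2 * Y := by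
    intro s hs0 hs1
    obtain ⟨μ, hμ, hμU⟩ : ∃ μ : ℂ, ‖μ‖ = 1 ∧ μ * U = ‖U‖ := by
      rcases eq_or_ne U 0 with h0 | h0
      · exact ⟨1, by simp, by simp [h0]⟩
      · have hn : (‖U‖ : ℂ) ≠ 0 := by simpa using h0
        refine ⟨conj U / ‖U‖, by simp [h0], ?_⟩
        have := Complex.conj_mul' U
        field_simp
        linear_combination this
    have hμ2 : μ.re ^ 2 + μ.im ^ 2 = 1 := by
      have : ‖μ‖ ^ 2 = 1 := by rw [hμ]; norm_num
      rw [← Complex.normSq_eq_norm_sq, Complex.normSq_apply] at this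
      linarith
    have hμre := congrArg Complex.re hμU
    have h1 := h (-(s * μ)) (by
      rw [norm_neg, norm_mul, hμ, Complex.norm_of_nonneg hs0]; linarith)
    have e : ((A + -(s * μ) * B) * conj (a + -(s * μ) * b)).re =
        X + s ^ 2 * (μ.re ^ 2 + μ.im ^ 2) * Y - s * (μ * U).re := by
      simp only [hX, hY, hU, Complex.add_re, Complex.add_im, Complex.neg_re, Complex.neg_im,
        Complex.mul_re, Complex.mul_im, Complex.conj_re, Complex.conj_im, Complex.ofReal_re,
        Complex.ofReal_im]
      ring
    rw [e, hμ2, hμre, Complex.ofReal_re] at h1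
    linarith
  have hXpos : 0 < X := by simpa using hs 0 le_rfl zero_le_one
  have hV0 := norm_nonneg V
  have hU0 := norm_nonneg U
  have hYX : Y < X := by
    by_contra! hcon
    have hYpos : 0 < Y := hXpos.trans_le hcon
    have hq : 0 ≤ X / Y := by positivity
    -- This s balances X and s²Y: the hypothesis gives s²|U|² < 4X², whereas |U|² ≥ 4XY gives the
    -- reverse.
    have h1 := hs (Real.sqrt (X / Y)) (Real.sqrt_nonneg _)
      (Real.sqrt_le_one.2 (div_le_one_of_le₀ hcon hYpos.le))
    rw [Real.sq_sqrt hq, div_mul_cancel₀ _ hYpos.ne'] at h1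
    have h2 : (Real.sqrt (X / Y) * ‖U‖) ^ 2 < (X + X) ^ 2 :=
      pow_lt_pow_left₀ h1 (by positivity) two_ne_zero
    rw [mul_pow, Real.sq_sqrt hq, hUV] at h2
    have h3 : X / Y * (4 * (X * Y)) = (X + X) ^ 2 := by field_simp; ring
    have h4 : 0 ≤ X / Y * ‖V‖ ^ 2 := by positivity
    nlinarith
  have h1 := hs 1 zero_le_one le_rfl
  -- From |U| < X + Y: |V|² = |U|² - 4XY < (X - Y)².
  have h2 : ‖V‖ < X - Y := by
    refine lt_of_pow_lt_pow_left₀ 2 (by linarith) ?_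
    nlinarith
  have h3 := (abs_le.1 (Complex.abs_re_le_norm V)).1
  have e : ((A - conj B) * conj (a + conj b)).re = X - Y + V.re := by
    simp only [hX, hY, hV, Complex.add_re, Complex.add_im, Complex.sub_re, Complex.sub_im,
      Complex.mul_re, Complex.conj_re, Complex.conj_im]
    ring
  rw [e]; linarith

/-- Analytic starlike functions are univalent. -/
theorem injOn_of_re_mul_conj_pos {K : ℂ → ℂ} {R : ℝ} (hR : 0 < R)
    (hK : DifferentiableOn ℂ K (ball 0 R)) (hK0 : K 0 = 0) (hK1 : deriv K 0 ≠ 0)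
    (hpos : ∀ z ∈ ball (0 : ℂ) R, z ≠ 0 → 0 < (z * deriv K z * conj (K z)).re) :
    InjOn K (ball 0 R) := by
  have hKne : ∀ z ∈ ball (0 : ℂ) R, z ≠ 0 → K z ≠ 0 := fun z hz hz0 h => by
    have := hpos z hz hz0
    simp [h] at this
  obtain ⟨L, hL, hE⟩ := exists_log_of_ne_zero hR (differentiableOn_dslope_ball hR hK)
    (fun z hz => by
      rcases eq_or_ne z 0 with rfl | hz0
      · rwa [dslope_same]
      · intro h
        refine hKne z hz hz0 ?_
        rw [eq_mul_dslope hK0 z, h, mul_zero])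
  have hKL : ∀ z ∈ ball (0 : ℂ) R, K z = z * Complex.exp (L z) := fun z hz => by
    rw [eq_mul_dslope hK0 z, hE z hz]
  have hexp : ∀ ζ ∈ {ζ : ℂ | ζ.re < Real.log R}, Complex.exp ζ ∈ ball (0 : ℂ) R := fun ζ hζ => by
    rw [mem_ball_zero_iff, Complex.norm_exp, ← Real.lt_log_iff_exp_lt hR]; exact hζ
  -- In the coordinate ζ = log z this function is a branch of log K, with derivative zK'/K of
  -- positive real part on a half-plane.
  have hinj : InjOn (fun ζ => ζ + L (Complex.exp ζ)) {ζ : ℂ | ζ.re < Real.log R} := by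
    refine injOn_of_re_deriv_pos (convex_halfSpace_re_lt _)
      (f' := fun ζ => 1 + deriv L (Complex.exp ζ) * Complex.exp ζ) (fun ζ hζ => ?_)
      (fun ζ hζ => ?_)
    · exact (hasDerivAt_id' ζ).add ((hL.differentiableAt
        (isOpen_ball.mem_nhds (hexp ζ hζ))).hasDerivAt.comp ζ (Complex.hasDerivAt_exp ζ))
    · have hz := hexp ζ hζ
      have hz0 := Complex.exp_ne_zero ζ
      set z := Complex.exp ζ with hzdef
      have hnhds := isOpen_ball.mem_nhds hz
      have hev : K =ᶠ[nhds z] fun z => z * Complex.exp (L z) := by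
        filter_upwards [hnhds] with y hy using hKL y hy
      have hd : deriv K z = Complex.exp (L z) * (1 + deriv L z * z) := by
        rw [hev.deriv_eq, ((hasDerivAt_id' z).fun_mul
          (hL.differentiableAt hnhds).hasDerivAt.cexp).deriv]
        ring
      have h1 := hpos z hz hz0
      have e : z * deriv K z * conj (K z) =
          (Complex.normSq (K z) : ℂ) * (1 + deriv L z * z) := by
        rw [← Complex.mul_conj, hd]
        nth_rewrite 2 [hKL z hz]
        ring
      rw [e, Complex.re_ofReal_mul] at h1
      exact pos_of_mul_pos_right h1 (Complex.normSq_nonneg _)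
  intro z₁ hz₁ z₂ hz₂ h12
  rcases eq_or_ne z₁ 0 with rfl | h1
  · by_contra hne
    exact hKne z₂ hz₂ (Ne.symm hne) (by rw [← h12, hK0])
  rcases eq_or_ne z₂ 0 with rfl | h2
  · exact absurd (by rw [h12, hK0]) (hKne z₁ hz₁ h1)
  have hlog : ∀ z ∈ ball (0 : ℂ) R, z ≠ 0 → (Complex.log z).re < Real.log R := fun z hz hz0 => by
    rw [Complex.log_re]
    exact Real.log_lt_log (norm_pos_iff.2 hz0) (mem_ball_zero_iff.1 hz)
  rw [hKL z₁ hz₁, hKL z₂ hz₂] at h12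
  obtain ⟨n, hn⟩ := Complex.exp_eq_exp_iff_exists_int.1
    (show Complex.exp (Complex.log z₁ + L z₁) = Complex.exp (Complex.log z₂ + L z₂) by
      rw [Complex.exp_add, Complex.exp_add, Complex.exp_log h1, Complex.exp_log h2, h12])
  -- The two logarithms of K may differ by 2πin. Shifting log z₂ by that amount stays in the
  -- half-plane and does not change z₂.
  have hper : Complex.exp (Complex.log z₂ + n * (2 * Real.pi * Complex.I)) = z₂ := by
    rw [Complex.exp_add, Complex.exp_int_mul_two_pi_mul_I, mul_one, Complex.exp_log h2]
  have := hinj (x₁ := Complex.log z₁) (hlog z₁ hz₁ h1)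
    (x₂ := Complex.log z₂ + n * (2 * Real.pi * Complex.I))
    (by simpa using hlog z₂ hz₂ h2) (by
      simp only [hper, Complex.exp_log h1]
      rw [hn]; ring)
  rw [← Complex.exp_log h1, this, hper]

/-! ### Curves with increasing argument and the domains they bound -/

/-- Since γ' = γΦ', one has Im (γ' conj γ) = |γ|² Im Φ'. -/
theorem im_div_pos_of_exp {γ Φ : ℝ → ℂ} (hΦ : Differentiable ℝ Φ)
    (hγ : ∀ t, γ t = Complex.exp (Φ t)) (hpos : ∀ t, 0 < (deriv γ t * conj (γ t)).im) (t : ℝ) :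
    HasDerivAt (fun t => (Φ t).im) (deriv Φ t).im t ∧ 0 < (deriv Φ t).im := by
  have hd := (hΦ t).hasDerivAt
  refine ⟨Complex.imCLM.hasFDerivAt.comp_hasDerivAt t hd, ?_⟩
  have h1 : deriv γ t = γ t * deriv Φ t := by
    rw [show γ = fun t => Complex.exp (Φ t) from funext hγ, hd.cexp.deriv]
  have h2 := hpos t
  rw [h1, show γ t * deriv Φ t * conj (γ t) = (Complex.normSq (γ t) : ℂ) * deriv Φ t by
    rw [← Complex.mul_conj]; ring, Complex.im_ofReal_mul] at h2
  exact pos_of_mul_pos_right h2 (Complex.normSq_nonneg _)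

theorem argDerivPos_of_exp {γ Φ : ℝ → ℂ} (hΦ : Differentiable ℝ Φ)
    (hγ : ∀ t, γ t = Complex.exp (Φ t)) (hpos : ∀ t, 0 < (deriv γ t * conj (γ t)).im) :
    ArgDerivPos γ := by
  have h := im_div_pos_of_exp hΦ hγ hpos
  refine ⟨fun t => (Φ t).im, fun t => (h t).1.differentiableAt, fun t => ⟨?_, ?_, ?_⟩⟩
  · rw [hγ]; exact Complex.exp_ne_zero _
  · rw [hγ, Complex.norm_exp, Complex.ofReal_exp, ← Complex.exp_add, Complex.re_add_im]
  · rw [(h t).1.deriv]; exact (h t).2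

theorem strictMono_im_of_exp {γ Φ : ℝ → ℂ} (hΦ : Differentiable ℝ Φ)
    (hγ : ∀ t, γ t = Complex.exp (Φ t)) (hpos : ∀ t, 0 < (deriv γ t * conj (γ t)).im) :
    StrictMono fun t => (Φ t).im := by
  have h := im_div_pos_of_exp hΦ hγ hpos
  exact strictMono_of_deriv_pos fun t => by rw [(h t).1.deriv]; exact (h t).2

theorem exists_mem_frontier_of_path {S : Set ℂ} {p : ℝ → ℂ} (hp : Continuous p) {s t : ℝ}
    (hst : s ≤ t) (hs : p s ∈ S) (ht : p t ∉ S) : ∃ u ∈ Icc s t, p u ∈ frontier S := by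
  have hconn : IsPreconnected (p '' Icc s t) := isPreconnected_Icc.image _ hp.continuousOn
  by_contra! hcon
  have hcov : p '' Icc s t ⊆ interior S ∪ (closure S)ᶜ := by
    rintro _ ⟨u, hu, rfl⟩
    by_cases h1 : p u ∈ interior S
    · exact Or.inl h1
    · exact Or.inr fun h2 => hcon u hu ⟨h2, h1⟩
  have hs' := mem_image_of_mem p (left_mem_Icc.2 hst)
  have ht' := mem_image_of_mem p (right_mem_Icc.2 hst)
  obtain ⟨x, -, hx1, hx2⟩ := hconn _ _ isOpen_interior isClosed_closure.isOpen_compl hcov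
    ⟨_, hs', (hcov hs').resolve_right fun h => h (subset_closure hs)⟩
    ⟨_, ht', (hcov ht').resolve_left fun h => ht (interior_subset h)⟩
  exact hx2 (subset_closure (interior_subset hx1))

/-- A bounded open set containing `0` whose boundary lies on a curve with increasing argument and
winding number one is starlike. -/
theorem starConvex_of_frontier_subset {S : Set ℂ} (hS : IsOpen S) (hb : Bornology.IsBounded S)
    (h0 : (0 : ℂ) ∈ S) {γ Φ : ℝ → ℂ} (hγ : ∀ t, γ t = Complex.exp (Φ t))
    (hmono : StrictMono fun t => (Φ t).im)
    (hper : ∀ t, ∀ n : ℤ, (Φ (t + n * (2 * Real.pi))).im = (Φ t).im + n * (2 * Real.pi))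
    (hγper : Function.Periodic γ (2 * Real.pi)) (hfr : frontier S ⊆ range γ) :
    StarConvex ℝ 0 S := by
  rw [starConvex_zero_iff]
  intro w hw a ha0 ha1
  by_contra hnot
  have hw0 : w ≠ 0 := by
    rintro rfl
    exact hnot (by rwa [smul_zero])
  have hcont : Continuous fun u : ℝ => u • w := by fun_prop
  -- If a • w is outside S, the ray through w meets the frontier before w, and by boundedness again
  -- beyond w.
  obtain ⟨τ₁, hτ₁, hf₁⟩ := exists_mem_frontier_of_path hcont ha0
    (by simpa using h0) hnot
  obtain ⟨C, hC⟩ := hb.exists_norm_le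
  have hwn : 0 < ‖w‖ := norm_pos_iff.2 hw0
  have hbig : (|C| / ‖w‖ + 1) • w ∉ S := fun h => by
    have := hC _ h
    rw [norm_smul, Real.norm_of_nonneg (by positivity), add_mul, div_mul_cancel₀ _ hwn.ne'] at this
    linarith [le_abs_self C]
  have hge : 1 ≤ |C| / ‖w‖ + 1 := by
    have : 0 ≤ |C| / ‖w‖ := by positivity
    linarith
  obtain ⟨τ₂, hτ₂, hf₂⟩ := exists_mem_frontier_of_path hcont hge (by simpa using hw) hbig
  have hnf : ∀ x ∈ S, x ∉ frontier S := fun x hx hxf => by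
    have : x ∈ S ∩ frontier S := ⟨hx, hxf⟩
    rw [hS.inter_frontier_eq] at this
    exact this
  have h1 : 0 ≤ τ₁ ∧ τ₁ ≤ 1 := ⟨hτ₁.1, hτ₁.2.trans ha1⟩
  have h2 : 1 ≤ τ₂ := hτ₂.1
  have h1ne : τ₁ ≠ 1 := by
    rintro rfl
    exact hnf _ hw (by simpa using hf₁)
  have h10 : 0 < τ₁ := lt_of_le_of_ne h1.1 (by
    rintro rfl
    exact hnf _ h0 (by simpa using hf₁))
  obtain ⟨t₁, ht₁⟩ := hfr hf₁
  obtain ⟨t₂, ht₂⟩ := hfr hf₂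
  have hτ2pos : 0 < τ₂ := zero_lt_one.trans_le h2
  have hrat : γ t₁ = ((τ₁ / τ₂ : ℝ) : ℂ) * γ t₂ := by
    have h3 : (τ₂ : ℂ) ≠ 0 := by exact_mod_cast hτ2pos.ne'
    simp only [ht₁, ht₂, Complex.real_smul]; push_cast; field_simp
  have hlog : ((τ₁ / τ₂ : ℝ) : ℂ) = Complex.exp ((Real.log (τ₁ / τ₂) : ℝ) : ℂ) := by
    rw [← Complex.ofReal_exp, Real.exp_log (div_pos h10 hτ2pos)]
  rw [hγ, hγ, hlog, ← Complex.exp_add, Complex.exp_eq_exp_iff_exists_int] at hrat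
  obtain ⟨n, hn⟩ := hrat
  -- Two curve points on one ray have arguments equal modulo 2π. Strict monotonicity then identifies
  -- the parameters modulo a period, hence the points.
  have him : (Φ t₁).im = (Φ (t₂ + n * (2 * Real.pi))).im := by
    rw [hper, hn]; simp
  have ht : t₁ = t₂ + n * (2 * Real.pi) := hmono.injective him
  have hγeq : γ t₁ = γ t₂ := by rw [ht]; exact hγper.int_mul n t₂
  rw [ht₁, ht₂] at hγeq
  have : τ₁ = τ₂ := smul_left_injective ℝ hw0 hγeq
  exact h1ne (le_antisymm h1.2 (this ▸ h2))

/-- A closed curve whose tangent turns monotonically, with winding number one, has a supporting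
line at each of its points. -/
theorem re_le_of_tangent {γ γ' Φ : ℝ → ℂ} (hγ : ∀ t, HasDerivAt γ (γ' t) t)
    (hΦ : Continuous Φ) (hγ' : ∀ t, γ' t = Complex.exp (Φ t))
    (hmono : StrictMono fun t => (Φ t).im)
    (hper : ∀ t, ∀ n : ℤ, (Φ (t + n * (2 * Real.pi))).im = (Φ t).im + n * (2 * Real.pi))
    (hγper : Function.Periodic γ (2 * Real.pi)) (t₀ t : ℝ) :
    (Complex.exp (-((Φ t₀).im * Complex.I)) * Complex.I * γ t).re ≤
      (Complex.exp (-((Φ t₀).im * Complex.I)) * Complex.I * γ t₀).re := by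
  obtain ⟨s, hs, hst⟩ := hγper.exists_mem_Ico Real.two_pi_pos t t₀
  rw [hst]
  set φ : ℝ → ℝ := fun t => (Φ t).im with hφ
  set c : ℂ := Complex.exp (-((Φ t₀).im * Complex.I)) * Complex.I with hc
  set q : ℝ → ℝ := fun t => (c * γ t).re with hq
  have hφc : Continuous φ := Complex.continuous_im.comp hΦ
  have hend : φ (t₀ + 2 * Real.pi) = φ t₀ + 2 * Real.pi := by
    simpa using hper t₀ 1
  -- The height of γ along the normal at t₀ has derivative -|γ'| sin(φ(u) - φ(t₀)). It decreases
  -- until the tangent has turned by π and then increases back to its initial value.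
  have hqd : ∀ u, HasDerivAt q (-(Real.exp (Φ u).re * Real.sin (φ u - φ t₀))) u := by
    intro u
    have h1 := Complex.reCLM.hasFDerivAt.comp_hasDerivAt u ((hγ u).const_mul c)
    refine h1.congr_deriv ?_
    rw [Complex.reCLM_apply, hγ', hc]
    have e : Complex.exp (-((Φ t₀).im * Complex.I)) * Complex.I * Complex.exp (Φ u) =
        Complex.exp (Φ u - (Φ t₀).im * Complex.I) * Complex.I := by
      rw [sub_eq_add_neg, Complex.exp_add]; ring
    rw [e, Complex.mul_I_re, Complex.exp_im]
    simp [hφ]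
  have hqc : Continuous q := continuous_iff_continuousAt.2 fun u => (hqd u).continuousAt
  have hpi := Real.pi_pos
  obtain ⟨t₁, ht₁, hφ₁⟩ : φ t₀ + Real.pi ∈ φ '' Icc t₀ (t₀ + 2 * Real.pi) :=
    intermediate_value_Icc (by linarith) hφc.continuousOn ⟨by linarith, by rw [hend]; linarith⟩
  have hanti : AntitoneOn q (Icc t₀ t₁) := by
    refine antitoneOn_of_deriv_nonpos (convex_Icc _ _) hqc.continuousOn
      (fun u _ => (hqd u).differentiableAt.differentiableWithinAt) fun u hu => ?_
    rw [interior_Icc] at hu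
    rw [(hqd u).deriv, neg_nonpos]
    have h1 : φ t₀ < φ u := hmono hu.1
    have h2 : φ u < φ t₁ := hmono hu.2
    exact mul_nonneg (Real.exp_pos _).le
      (Real.sin_nonneg_of_nonneg_of_le_pi (by linarith) (by linarith))
  have hmon : MonotoneOn q (Icc t₁ (t₀ + 2 * Real.pi)) := by
    refine monotoneOn_of_deriv_nonneg (convex_Icc _ _) hqc.continuousOn
      (fun u _ => (hqd u).differentiableAt.differentiableWithinAt) fun u hu => ?_
    rw [interior_Icc] at hu
    rw [(hqd u).deriv, neg_nonneg]
    have h1 : φ t₁ < φ u := hmono hu.1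
    have h2 : φ u < φ (t₀ + 2 * Real.pi) := hmono hu.2
    refine mul_nonpos_of_nonneg_of_nonpos (Real.exp_pos _).le ?_
    rw [← Real.sin_sub_two_pi]
    exact Real.sin_nonpos_of_nonpos_of_neg_pi_le (by linarith) (by linarith)
  change q s ≤ q t₀
  rcases le_total s t₁ with h | h
  · exact hanti ⟨le_rfl, ht₁.1⟩ ⟨hs.1, h⟩ hs.1
  · have h3 := hmon ⟨h, hs.2.le⟩ ⟨ht₁.2, le_rfl⟩ hs.2.le
    have h4 : q (t₀ + 2 * Real.pi) = q t₀ := by simp only [hq, hγper t₀]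
    linarith

/-- A bounded open set whose boundary lies on a closed curve, all of which have a supporting line
at each point of the curve, is convex. -/
theorem convex_of_frontier_subset {S : Set ℂ} (hS : IsOpen S) (hb : Bornology.IsBounded S)
    {γ : ℝ → ℂ} (hfr : frontier S ⊆ range γ)
    (hsupp : ∀ t₀, ∃ c : ℂ, c ≠ 0 ∧ ∀ t, (c * γ t).re ≤ (c * γ t₀).re) : Convex ℝ S := by
  have hlt : ∀ t₀ (c : ℂ), c ≠ 0 → (∀ t, (c * γ t).re ≤ (c * γ t₀).re) →
      ∀ s ∈ S, (c * s).re < (c * γ t₀).re := by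
    intro t₀ c hc hle s hs
    -- A nonzero linear functional has no maximum on an open set, so its maximum over the closure is
    -- attained on the frontier, hence on γ.
    have hnomax : ∀ x ∈ S, ∃ y ∈ S, (c * x).re < (c * y).re := by
      intro x hx
      have hcont : ContinuousAt (fun ε : ℝ => x + ε * conj c) 0 := by fun_prop
      have hev : ∀ᶠ ε : ℝ in nhdsWithin 0 (Ioi 0), x + ε * conj c ∈ S :=
        (hcont.eventually (by simpa using hS.mem_nhds hx)).filter_mono nhdsWithin_le_nhds
      obtain ⟨ε, hε, hε0⟩ := (hev.and self_mem_nhdsWithin).exists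
      refine ⟨_, hε, ?_⟩
      have e : c * (x + ε * conj c) = c * x + ((ε * Complex.normSq c : ℝ) : ℂ) := by
        push_cast; rw [← Complex.mul_conj]; ring
      rw [e, Complex.add_re, Complex.ofReal_re]
      have := mul_pos (show 0 < ε from hε0) (Complex.normSq_pos.2 hc)
      linarith
    obtain ⟨m, hm, hmax⟩ := hb.isCompact_closure.exists_isMaxOn ⟨s, subset_closure hs⟩
      (f := fun x => (c * x).re) (by fun_prop)
    have hmS : m ∉ S := fun h => by
      obtain ⟨y, hy, hlt⟩ := hnomax m h
      exact absurd hlt (not_lt.2 (hmax (subset_closure hy)))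
    obtain ⟨t, rfl⟩ := hfr ⟨hm, fun h => hmS (interior_subset h)⟩
    obtain ⟨y, hy, hlt⟩ := hnomax s hs
    exact hlt.trans_le ((hmax (subset_closure hy)).trans (hle t))
  intro x hx y hy a b ha hb' hab
  by_contra hnot
  have hcont : Continuous fun u : ℝ => x + u * (y - x) := by fun_prop
  have hend : x + b * (y - x) ∉ S := by
    have e : a • x + b • y = x + b * (y - x) := by
      rw [Complex.real_smul, Complex.real_smul, eq_sub_of_add_eq hab]; push_cast; ring
    rwa [← e]
  obtain ⟨u, hu, hfu⟩ := exists_mem_frontier_of_path hcont hb' (by simpa using hx) hend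
  obtain ⟨t₀, ht₀⟩ := hfr hfu
  obtain ⟨c, hc, hle⟩ := hsupp t₀
  have h1 := hlt t₀ c hc hle x hx
  have h2 := hlt t₀ c hc hle y hy
  have e : (c * γ t₀).re = (1 - u) * (c * x).re + u * (c * y).re := by
    rw [ht₀, show c * (x + u * (y - x)) = ((1 - u : ℝ) : ℂ) * (c * x) + (u : ℂ) * (c * y) by
      push_cast; ring, Complex.add_re, Complex.re_ofReal_mul, Complex.re_ofReal_mul]
  have hu1 : u ≤ 1 := by linarith [hu.2]
  have h3 := mul_nonneg hu.1 (sub_nonneg.2 h2.le)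
  rcases hu1.lt_or_eq with hu1 | rfl
  · have := mul_pos (sub_pos.2 hu1) (sub_pos.2 h1)
    linarith
  · linarith

/-! ### Application to the pair (h, g) -/

/-- The analytic and co-analytic parts of a member of the class `M(α)`. -/
structure IsPair (α : ℂ) (h g : ℂ → ℂ) : Prop where
  alpha : ‖α‖ ≤ 1
  hd : DifferentiableOn ℂ h (ball 0 1)
  gd : DifferentiableOn ℂ g (ball 0 1)
  h_zero : h 0 = 0
  g_zero : g 0 = 0
  deriv_h_zero : deriv h 0 = 1
  deriv_g : ∀ z ∈ ball (0 : ℂ) 1, deriv g z = α * z * deriv h z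
  deriv_h_ne : ∀ z ∈ ball (0 : ℂ) 1, deriv h z ≠ 0
  re_gt : ∀ z ∈ ball (0 : ℂ) 1, -(3 / 2) < (z * deriv (deriv h) z / deriv h z).re

theorem radius_lt_one {r : ℝ} (hr : r < 4 * Real.sqrt 2 - 5) : r < 1 := by
  have hs2 : Real.sqrt 2 ^ 2 = 2 := Real.sq_sqrt (by norm_num)
  nlinarith [Real.sqrt_nonneg 2]

theorem starlike_radius_pos : 0 < 4 * Real.sqrt 2 - 5 := by
  have hs2 : Real.sqrt 2 ^ 2 = 2 := Real.sq_sqrt (by norm_num)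
  nlinarith [Real.sqrt_nonneg 2]

theorem convex_radius_pos : 0 < 2 - Real.sqrt 3 := by
  have hs3 : Real.sqrt 3 ^ 2 = 3 := Real.sq_sqrt (by norm_num)
  nlinarith [Real.sqrt_nonneg 3]

theorem convex_radius_le_starlike_radius : 2 - Real.sqrt 3 ≤ 4 * Real.sqrt 2 - 5 := by
  have h2 : (7 / 5 : ℝ) ≤ Real.sqrt 2 := Real.le_sqrt_of_sq_le (by norm_num)
  have h3 : (7 / 5 : ℝ) ≤ Real.sqrt 3 := Real.le_sqrt_of_sq_le (by norm_num)
  linarith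

namespace IsPair

variable {α : ℂ} {h g : ℂ → ℂ}

theorem hasDerivAt_h (H : IsPair α h g) {z : ℂ} (hz : ‖z‖ < 1) : HasDerivAt h (deriv h z) z :=
  (H.hd.differentiableAt (isOpen_ball.mem_nhds (by simpa using hz))).hasDerivAt

theorem hasDerivAt_deriv_h (H : IsPair α h g) {z : ℂ} (hz : ‖z‖ < 1) :
    HasDerivAt (deriv h) (deriv (deriv h) z) z :=
  ((H.hd.deriv isOpen_ball).differentiableAt
    (isOpen_ball.mem_nhds (by simpa using hz))).hasDerivAt

theorem hasDerivAt_g (H : IsPair α h g) {z : ℂ} (hz : ‖z‖ < 1) :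
    HasDerivAt g (α * z * deriv h z) z := by
  have hb : z ∈ ball (0 : ℂ) 1 := by simpa using hz
  rw [← H.deriv_g z hb]
  exact (H.gd.differentiableAt (isOpen_ball.mem_nhds hb)).hasDerivAt

theorem hasDerivAt_add_mul (H : IsPair α h g) (lam : ℂ) {z : ℂ} (hz : ‖z‖ < 1) :
    HasDerivAt (fun z => h z + lam * g z) (deriv h z * (1 + lam * α * z)) z :=
  ((H.hasDerivAt_h hz).add ((H.hasDerivAt_g hz).const_mul lam)).congr_deriv (by ring)

theorem re_mul_conj_pos (H : IsPair α h g) {lam : ℂ} (hlam : ‖lam‖ ≤ 1) {z : ℂ}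
    (hz0 : z ≠ 0) (hz : ‖z‖ < 4 * Real.sqrt 2 - 5) :
    0 < (z * (deriv h z * (1 + lam * α * z)) * conj (h z + lam * g z)).re :=
  re_mul_conj_pos_of_koebe (K := fun z => h z + lam * g z) H.hd H.deriv_h_ne H.re_gt
    (by rw [norm_mul]; nlinarith [H.alpha, norm_nonneg α, norm_nonneg lam])
    (by simp [H.h_zero, H.g_zero])
    (fun z hz => H.hasDerivAt_add_mul lam (by simpa using hz)) hz0 hz

theorem harmonic_pos (H : IsPair α h g) {z : ℂ} (hz0 : z ≠ 0) (hz : ‖z‖ < 4 * Real.sqrt 2 - 5) :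
    ‖g z‖ < ‖h z‖ ∧ 0 < ((z * deriv h z - conj (α * z * (z * deriv h z))) *
      conj (h z + conj (g z))).re :=
  harmonic_re_pos fun lam hlam => by
    have := H.re_mul_conj_pos hlam hz0 hz
    rwa [show z * (deriv h z * (1 + lam * α * z)) =
      z * deriv h z + lam * (α * z * (z * deriv h z)) by ring] at this

theorem injOn (H : IsPair α h g) :
    InjOn (fun z => h z + conj (g z)) (ball 0 (4 * Real.sqrt 2 - 5)) := by
  have hlt : ∀ z ∈ ball (0 : ℂ) (4 * Real.sqrt 2 - 5), ‖z‖ < 1 := fun z hz =>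
    radius_lt_one (by simpa using hz)
  intro z₁ hz₁ z₂ hz₂ h12
  obtain ⟨lam, hlam, heq⟩ : ∃ lam : ℂ, ‖lam‖ ≤ 1 ∧ h z₁ + lam * g z₁ = h z₂ + lam * g z₂ := by
    rcases eq_or_ne (g z₁) (g z₂) with hg | hg
    · refine ⟨1, by simp, ?_⟩
      simp only [hg] at h12 ⊢
      simpa using h12
    -- This unimodular lam turns the conjugate of g z₁ - g z₂ into a multiple of it; it depends on
    -- the pair of points, so all lam are needed.
    · have hne := sub_ne_zero.2 hg
      refine ⟨conj (g z₁ - g z₂) / (g z₁ - g z₂), ?_, ?_⟩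
      · rw [norm_div, Complex.norm_conj]; exact div_self_le_one _
      · have : conj (g z₁ - g z₂) / (g z₁ - g z₂) * (g z₁ - g z₂) = conj (g z₁) - conj (g z₂) := by
          rw [div_mul_cancel₀ _ hne, map_sub]
        simp only at h12
        linear_combination h12 + this
  refine injOn_of_re_mul_conj_pos (K := fun z => h z + lam * g z) starlike_radius_pos
    (fun z hz => (H.hasDerivAt_add_mul lam (hlt z hz)).differentiableAt.differentiableWithinAt)
    (by simp [H.h_zero, H.g_zero]) ?_ (fun z hz hz0 => ?_) hz₁ hz₂ heq
  · rw [(H.hasDerivAt_add_mul lam (by simp)).deriv, H.deriv_h_zero]; simp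
  · rw [(H.hasDerivAt_add_mul lam (hlt z hz)).deriv]
    exact H.re_mul_conj_pos hlam hz0 (by simpa using hz)

end IsPair

/-! ### Real derivative, openness and frontier of the image -/

/-- The real linear map `v ↦ a v + conj (b v)`. -/
noncomputable def harmonicCLM (a b : ℂ) : ℂ →L[ℝ] ℂ :=
  a • (1 : ℂ →L[ℝ] ℂ) + (Complex.conjCLE : ℂ →L[ℝ] ℂ).comp (b • (1 : ℂ →L[ℝ] ℂ))

theorem harmonicCLM_apply (a b v : ℂ) : harmonicCLM a b v = a * v + conj (b * v) := by
  simp [harmonicCLM]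

theorem det_harmonicCLM (a b : ℂ) : (harmonicCLM a b).det = ‖a‖ ^ 2 - ‖b‖ ^ 2 := by
  rw [ContinuousLinearMap.det, ← LinearMap.det_toMatrix Complex.basisOneI, Matrix.det_fin_two]
  simp only [LinearMap.toMatrix_apply, Complex.coe_basisOneI_repr, Complex.coe_basisOneI,
    ContinuousLinearMap.coe_coe, harmonicCLM_apply]
  simp only [← Complex.normSq_eq_norm_sq, Complex.normSq_apply]
  simp
  ring

theorem hasStrictFDerivAt_harmonic {h g : ℂ → ℂ} {z : ℂ} (hh : AnalyticAt ℂ h z)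
    (hg : AnalyticAt ℂ g z) :
    HasStrictFDerivAt (fun z => h z + conj (g z)) (harmonicCLM (deriv h z) (deriv g z)) z := by
  have h1 := hh.hasStrictDerivAt.hasStrictFDerivAt.restrictScalars ℝ
  have h2 := hg.hasStrictDerivAt.hasStrictFDerivAt.restrictScalars ℝ
  have h3 := (Complex.conjCLE : ℂ →L[ℝ] ℂ).hasStrictFDerivAt.comp z h2
  refine (h1.add h3).congr_fderiv ?_
  ext v; simp [harmonicCLM, mul_comm]

theorem range_eq_top_of_det_ne_zero {A : ℂ →L[ℝ] ℂ} (hA : A.det ≠ 0) :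
    (A : ℂ →ₗ[ℝ] ℂ).range = ⊤ :=
  LinearMap.range_eq_top.2 ((LinearMap.equivOfDetNeZero _ hA).surjective)

namespace IsPair

variable {α : ℂ} {h g f : ℂ → ℂ}

theorem exists_hasStrictFDerivAt (H : IsPair α h g)
    (hf : ∀ z ∈ ball (0 : ℂ) 1, f z = h z + conj (g z)) {z : ℂ} (hz : z ∈ ball (0 : ℂ) 1) :
    ∃ A : ℂ →L[ℝ] ℂ, HasStrictFDerivAt f A z ∧ 0 < A.det := by
  have hnhds := isOpen_ball.mem_nhds hz
  refine ⟨_, (hasStrictFDerivAt_harmonic (H.hd.analyticAt hnhds)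
    (H.gd.analyticAt hnhds)).congr_of_eventuallyEq ?_, ?_⟩
  · filter_upwards [hnhds] with y hy using (hf y hy).symm
  · rw [det_harmonicCLM, H.deriv_g z hz, norm_mul, norm_mul]
    have h1 : 0 < ‖deriv h z‖ := norm_pos_iff.2 (H.deriv_h_ne z hz)
    have h2 : ‖α‖ * ‖z‖ < 1 := by
      have := mem_ball_zero_iff.1 hz
      nlinarith [H.alpha, norm_nonneg α, norm_nonneg z]
    have h3 : (‖α‖ * ‖z‖) ^ 2 < 1 := by
      have : 0 ≤ ‖α‖ * ‖z‖ := by positivity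
      nlinarith
    rw [mul_pow]
    have : 0 < ‖deriv h z‖ ^ 2 := by positivity
    nlinarith

theorem univalentSensePreserving (H : IsPair α h g)
    (hf : ∀ z ∈ ball (0 : ℂ) 1, f z = h z + conj (g z)) {R : ℝ} (hR : R ≤ 4 * Real.sqrt 2 - 5) :
    UnivalentSensePreserving f R := by
  have hsub : ball (0 : ℂ) (4 * Real.sqrt 2 - 5) ⊆ ball 0 1 := fun z hz => by
    rw [mem_ball_zero_iff] at hz ⊢; exact radius_lt_one hz
  have hsub' := ball_subset_ball (x := (0 : ℂ)) hR
  constructor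
  · exact (H.injOn.congr fun z hz => (hf z (hsub hz)).symm).mono hsub'
  · intro z hz
    obtain ⟨A, hA, hdet⟩ := H.exists_hasStrictFDerivAt hf (hsub (hsub' hz))
    exact ⟨hA.hasFDerivAt.differentiableAt, by rwa [hA.hasFDerivAt.fderiv]⟩

theorem isOpen_image (H : IsPair α h g)
    (hf : ∀ z ∈ ball (0 : ℂ) 1, f z = h z + conj (g z)) {r : ℝ} (hr : r < 1) :
    IsOpen (f '' ball 0 r) := by
  rw [isOpen_iff_mem_nhds]
  rintro _ ⟨z, hz, rfl⟩
  obtain ⟨A, hA, hdet⟩ := H.exists_hasStrictFDerivAt hf (ball_subset_ball hr.le hz)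
  rw [← hA.map_nhds_eq_of_surj (range_eq_top_of_det_ne_zero hdet.ne')]
  exact Filter.image_mem_map (isOpen_ball.mem_nhds hz)

theorem closure_image_subset (H : IsPair α h g)
    (hf : ∀ z ∈ ball (0 : ℂ) 1, f z = h z + conj (g z)) {r : ℝ} (hr : r < 1) :
    closure (f '' ball 0 r) ⊆ f '' closedBall 0 r ∧ Bornology.IsBounded (f '' ball 0 r) := by
  have hc : IsCompact (f '' closedBall 0 r) := (isCompact_closedBall 0 r).image_of_continuousOn
    fun z hz => by
      obtain ⟨A, hA, -⟩ := H.exists_hasStrictFDerivAt hf (closedBall_subset_ball hr hz)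
      exact hA.hasFDerivAt.continuousAt.continuousWithinAt
  have hsub : f '' ball 0 r ⊆ f '' closedBall 0 r := image_mono ball_subset_closedBall
  exact ⟨closure_minimal hsub hc.isClosed, hc.isBounded.subset hsub⟩

theorem frontier_image_subset (H : IsPair α h g)
    (hf : ∀ z ∈ ball (0 : ℂ) 1, f z = h z + conj (g z)) {r : ℝ} (hr : r < 1) :
    frontier (f '' ball 0 r) ⊆ range (imageOfCircle f r) := by
  rw [(H.isOpen_image hf hr).frontier_eq]
  rintro w ⟨hw, hnw⟩
  obtain ⟨z, hz, rfl⟩ := (H.closure_image_subset hf hr).1 hw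
  have hzr : ‖z‖ = r := by
    refine le_antisymm (by simpa using hz) (not_lt.1 fun hlt => hnw ⟨z, by simpa using hlt, rfl⟩)
  refine ⟨z.arg, ?_⟩
  rw [imageOfCircle, ← hzr, Complex.norm_mul_exp_arg_mul_I]

end IsPair

/-! ### Logarithms along circles -/

theorem norm_circle {r : ℝ} (hr : 0 ≤ r) (t : ℝ) : ‖(r * Complex.exp (t * Complex.I) : ℂ)‖ = r := by
  rw [norm_mul, Complex.norm_exp_ofReal_mul_I, mul_one, Complex.norm_of_nonneg hr]

theorem circle_ne_zero {r : ℝ} (hr : 0 < r) (t : ℝ) : (r * Complex.exp (t * Complex.I) : ℂ) ≠ 0 :=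
  mul_ne_zero (by exact_mod_cast hr.ne') (Complex.exp_ne_zero _)

theorem hasDerivAt_circle (r t : ℝ) :
    HasDerivAt (fun t : ℝ => (r * Complex.exp (t * Complex.I) : ℂ))
      (r * Complex.exp (t * Complex.I) * Complex.I) t := by
  have h1 : HasDerivAt (fun s : ℝ => (s : ℂ) * Complex.I) Complex.I t := by
    simpa using (Complex.ofRealCLM.hasDerivAt (x := t)).mul_const Complex.I
  exact (h1.cexp.const_mul (r : ℂ)).congr_deriv (by ring)

theorem circle_add_int_mul (r t : ℝ) (n : ℤ) :
    (r * Complex.exp ((t + n * (2 * Real.pi) : ℝ) * Complex.I) : ℂ) =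
      r * Complex.exp (t * Complex.I) := by
  rw [show (((t + n * (2 * Real.pi) : ℝ) : ℂ) * Complex.I) =
    t * Complex.I + n * (2 * Real.pi * Complex.I) by push_cast; ring, Complex.exp_add,
    Complex.exp_int_mul_two_pi_mul_I, mul_one]

theorem circle_eq_exp {r : ℝ} (hr : 0 < r) (t : ℝ) :
    (r * Complex.exp (t * Complex.I) : ℂ) = Complex.exp ((Real.log r : ℝ) + t * Complex.I) := by
  rw [Complex.exp_add, ← Complex.ofReal_exp, Real.exp_log hr]

theorem hasDerivAt_conj {u : ℝ → ℂ} {u' : ℂ} {t : ℝ} (h : HasDerivAt u u' t) :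
    HasDerivAt (fun t => conj (u t)) (conj u') t :=
  (Complex.conjCLE : ℂ →L[ℝ] ℂ).hasFDerivAt.comp_hasDerivAt t h

theorem mem_slitPlane_one_add {w : ℂ} (hw : ‖w‖ < 1) : 1 + w ∈ Complex.slitPlane := by
  refine Or.inl ?_
  have := (abs_lt.1 ((Complex.abs_re_le_norm w).trans_lt hw)).1
  rw [Complex.add_re, Complex.one_re]; linarith

/-- The curves considered below have the form `z e^{M(z)} (1 + w)` with `|w| < 1`, where `z` runs
on a circle, and hence have an explicit logarithm. -/
theorem exists_log_circle {M : ℂ → ℂ} {w : ℝ → ℂ} {r : ℝ} (c : ℂ) (hr : 0 < r)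
    (hM : ∀ z : ℂ, ‖z‖ = r → DifferentiableAt ℂ M z) (hw : Differentiable ℝ w)
    (hw1 : ∀ t, ‖w t‖ < 1) (hwper : ∀ t, ∀ n : ℤ, w (t + n * (2 * Real.pi)) = w t) :
    ∃ Φ : ℝ → ℂ, Differentiable ℝ Φ ∧
      (∀ t : ℝ, Complex.exp c * (r * Complex.exp (t * Complex.I)) *
        Complex.exp (M (r * Complex.exp (t * Complex.I))) * (1 + w t) = Complex.exp (Φ t)) ∧
      ∀ t, ∀ n : ℤ, (Φ (t + n * (2 * Real.pi))).im = (Φ t).im + n * (2 * Real.pi) := by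
  refine ⟨fun t => c + ((Real.log r : ℝ) + t * Complex.I) +
    M (r * Complex.exp (t * Complex.I)) + Complex.log (1 + w t), fun t => ?_, fun t => ?_,
    fun t n => ?_⟩
  · have h1 : DifferentiableAt ℝ (fun t : ℝ => M (r * Complex.exp (t * Complex.I))) t :=
      (HasDerivAt.comp t (hM _ (norm_circle hr.le t)).hasDerivAt
        (hasDerivAt_circle r t)).differentiableAt
    have h2 : DifferentiableAt ℝ (fun t => Complex.log (1 + w t)) t :=
      (((hw t).hasDerivAt.const_add 1).clog_real (mem_slitPlane_one_add (hw1 t))).differentiableAt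
    have h3 : DifferentiableAt ℝ (fun t : ℝ => (t : ℂ) * Complex.I) t :=
      ((Complex.ofRealCLM.hasDerivAt (x := t)).mul_const Complex.I).differentiableAt
    exact (((h3.const_add _).const_add c).add h1).add h2
  · rw [Complex.exp_add, Complex.exp_add, Complex.exp_add, ← circle_eq_exp hr,
      Complex.exp_log (Complex.slitPlane_ne_zero (mem_slitPlane_one_add (hw1 t)))]
  · simp only [circle_add_int_mul, hwper]
    simp
    ring

/-! ### Turning of the tangent and the radius 2 - √3 -/

/-- Applied with F = zh', P = 1 + zh''/h', a = αz. Divided by |F|², the expression is at least (1 +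
|a|)(Re P (1 - |a|) - |a|). With the bound on Re P, positivity reduces to (1 - 2r)(1 - r) > r(1 +
r), i.e. 1 - 4r + r² > 0, whose smaller root is 2 - √3. -/
theorem convex_numerator_pos {F P a : ℂ} {r : ℝ} (hF : F ≠ 0) (hr0 : 0 ≤ r)
    (hr : r < 2 - Real.sqrt 3) (ha : ‖a‖ ≤ r) (hP : (1 - 2 * r) / (1 + r) ≤ P.re) :
    0 < ((P * F + conj (a * (1 + P) * F)) * conj (F - conj (a * F))).re := by
  have hs3 : Real.sqrt 3 ^ 2 = 3 := Real.sq_sqrt (by norm_num)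
  have hs := Real.sqrt_nonneg 3
  have hr1 : r < 1 := by nlinarith
  have hq : 0 < 1 - 4 * r + r ^ 2 := by nlinarith
  have e : ((P * F + conj (a * (1 + P) * F)) * conj (F - conj (a * F))).re =
      ‖F‖ ^ 2 * (P.re * (1 - ‖a‖ ^ 2) - ‖a‖ ^ 2) + (a * F ^ 2).re := by
    simp only [← Complex.normSq_eq_norm_sq, Complex.normSq_apply]
    simp only [Complex.add_re, Complex.add_im, Complex.sub_re, Complex.sub_im, Complex.mul_re,
      Complex.mul_im, Complex.conj_re, Complex.conj_im, Complex.one_re, Complex.one_im, pow_two]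
    ring
  have h1 : -(‖F‖ ^ 2 * ‖a‖) ≤ (a * F ^ 2).re := by
    have h2 := (abs_le.1 (Complex.abs_re_le_norm (a * F ^ 2))).1
    rwa [norm_mul, norm_pow, mul_comm] at h2
  have hFp : 0 < ‖F‖ ^ 2 := by have := norm_pos_iff.2 hF; positivity
  have hP' : 1 - 2 * r ≤ P.re * (1 + r) := (div_le_iff₀ (by linarith)).1 hP
  have ha0 := norm_nonneg a
  have hPpos : 0 < P.re := by
    by_contra! hcon
    nlinarith
  have h3 : ‖a‖ < P.re * (1 - ‖a‖) := by
    have h4 : r < P.re * (1 - r) := by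
      by_contra! hcon
      nlinarith
    nlinarith
  have h5 : 0 < P.re * (1 - ‖a‖ ^ 2) - ‖a‖ ^ 2 - ‖a‖ := by
    have : 0 < (1 + ‖a‖) * (P.re * (1 - ‖a‖) - ‖a‖) := mul_pos (by linarith) (by linarith)
    linarith
  have h6 := mul_pos hFp h5
  rw [e]
  linarith

theorem im_mul_conj_I_mul (a b : ℂ) : ((Complex.I * a) * conj b).im = (a * conj b).re := by
  rw [mul_assoc, Complex.I_mul_im]

theorem im_neg_mul_conj_I_mul (a b : ℂ) : (-a * conj (Complex.I * b)).im = (a * conj b).re := by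
  rw [map_mul, Complex.conj_I, show -a * (-Complex.I * conj b) = Complex.I * (a * conj b) by ring,
    Complex.I_mul_im]

namespace IsPair

variable {α : ℂ} {h g f : ℂ → ℂ}

/-- The quantity is Re (1 + 3u/(1 - u)) with |u| ≤ |z|, and the bound is its value at u = -|z|. -/
theorem re_one_add_ge (H : IsPair α h g) {z : ℂ} (hz : ‖z‖ < 1) :
    (1 - 2 * ‖z‖) / (1 + ‖z‖) ≤ (1 + z * deriv (deriv h) z / deriv h z).re := by
  obtain ⟨k, hk⟩ := exists_schwarz_factor H.hd H.deriv_h_ne H.re_gt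
  have hb : z ∈ ball (0 : ℂ) 1 := by simpa using hz
  obtain ⟨hk1, hk2⟩ := hk z hb
  have hz0 := norm_nonneg z
  set u := k z * z with hu
  have hule : ‖u‖ ≤ ‖z‖ := by rw [hu, norm_mul]; nlinarith
  have hne := H.deriv_h_ne z hb
  have hu1 : u ≠ 1 := ne_one_of_norm_lt_one (hule.trans_lt hz)
  have h1 := sub_ne_zero.2 hu1.symm
  have e : z * deriv (deriv h) z / deriv h z = ((3 : ℝ) : ℂ) * (u / (1 - u)) := by
    push_cast
    field_simp
    rw [mul_assoc, hk2, hu]; ring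
  have hpos : 0 < ‖1 - u‖ := norm_pos_iff.2 h1
  have hle : ‖1 - u‖ ≤ 1 + ‖z‖ := by
    have := norm_sub_le 1 u
    rw [norm_one] at this; linarith
  have hge : (1 - ‖z‖ ^ 2) / (2 * (1 + ‖z‖) ^ 2) ≤ (1 - ‖u‖ ^ 2) / (2 * ‖1 - u‖ ^ 2) := by
    have hu0 := norm_nonneg u
    apply div_le_div₀ <;> first | positivity | nlinarith
  have e2 : (1 - 2 * ‖z‖) / (1 + ‖z‖) =
      1 + 3 * (-(1 / 2) + (1 - ‖z‖ ^ 2) / (2 * (1 + ‖z‖) ^ 2)) := by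
    have : 1 + ‖z‖ ≠ 0 := by positivity
    field_simp; ring
  rw [Complex.add_re, Complex.one_re, e, Complex.re_ofReal_mul, re_div_one_sub hu1, e2]
  linarith

theorem hasDerivAt_imageOfCircle (H : IsPair α h g)
    (hf : ∀ z ∈ ball (0 : ℂ) 1, f z = h z + conj (g z)) {r : ℝ} (hr0 : 0 ≤ r) (hr : r < 1) (t : ℝ) :
    HasDerivAt (imageOfCircle f r) (Complex.I *
      (r * Complex.exp (t * Complex.I) * deriv h (r * Complex.exp (t * Complex.I)) -
        conj (α * (r * Complex.exp (t * Complex.I)) * (r * Complex.exp (t * Complex.I) *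
          deriv h (r * Complex.exp (t * Complex.I)))))) t := by
  have hlt : ∀ t : ℝ, ‖(r * Complex.exp (t * Complex.I) : ℂ)‖ < 1 := fun t => by
    rwa [norm_circle hr0]
  have e : imageOfCircle f r = fun t : ℝ => h (r * Complex.exp (t * Complex.I)) +
      conj (g (r * Complex.exp (t * Complex.I))) :=
    funext fun t => hf _ (mem_ball_zero_iff.2 (hlt t))
  rw [e]
  have hc := hasDerivAt_circle r t
  have h1 := (HasDerivAt.comp t (H.hasDerivAt_h (hlt t)) hc).add
    (hasDerivAt_conj (HasDerivAt.comp t (H.hasDerivAt_g (hlt t)) hc))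
  refine h1.congr_deriv ?_
  simp only [map_mul, Complex.conj_I]
  ring

theorem hasDerivAt_deriv_imageOfCircle (H : IsPair α h g)
    (hf : ∀ z ∈ ball (0 : ℂ) 1, f z = h z + conj (g z)) {r : ℝ} (hr0 : 0 < r) (hr : r < 1) (t : ℝ)
    {z F P : ℂ} (hz : z = r * Complex.exp (t * Complex.I)) (hF : F = z * deriv h z)
    (hP : P = 1 + z * deriv (deriv h) z / deriv h z) :
    HasDerivAt (deriv (imageOfCircle f r)) (-(P * F + conj (α * z * (1 + P) * F))) t := by
  have hlt : ∀ t : ℝ, ‖(r * Complex.exp (t * Complex.I) : ℂ)‖ < 1 := fun t => by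
    rwa [norm_circle hr0.le]
  have hc := hasDerivAt_circle r t
  rw [funext fun t => (H.hasDerivAt_imageOfCircle hf hr0.le hr t).deriv]
  have hne := H.deriv_h_ne z (by rw [hz]; simpa using hlt t)
  have h1 := hc.mul (HasDerivAt.comp t (H.hasDerivAt_deriv_h (hlt t)) hc)
  have h2 := (h1.sub (hasDerivAt_conj ((hc.const_mul α).mul h1))).const_mul Complex.I
  refine h2.congr_deriv ?_
  simp only [Function.comp_apply, Pi.mul_apply, ← hz]
  have hPF : P * F = z * (deriv h z + z * deriv (deriv h) z) := by
    rw [hP, hF]; field_simp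
  rw [show α * z * (1 + P) * F = α * z * (F + P * F) by ring, hPF, hF]
  simp only [map_mul, map_add, Complex.conj_I]
  linear_combination (z * (deriv h z + z * deriv (deriv h) z) + conj α * conj z *
    (conj z * conj (deriv h z) + conj z * (conj (deriv h z) +
      conj z * conj (deriv (deriv h) z)))) * Complex.I_mul_I

theorem periodic_imageOfCircle (f : ℂ → ℂ) (r : ℝ) :
    Function.Periodic (imageOfCircle f r) (2 * Real.pi) := fun t => by
  have := circle_add_int_mul r t 1
  simp only [Int.cast_one, one_mul] at this
  simp only [imageOfCircle, this]

/-! ### Images of smaller disks and conclusion -/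

theorem starlike_of_lt (H : IsPair α h g)
    (hf : ∀ z ∈ ball (0 : ℂ) 1, f z = h z + conj (g z)) {r : ℝ} (hr0 : 0 < r)
    (hr : r < 4 * Real.sqrt 2 - 5) :
    IsStarlikeDomain (f '' ball 0 r) ∧ ArgDerivPos (imageOfCircle f r) := by
  have hr1 := radius_lt_one hr
  have hR : ball (0 : ℂ) (4 * Real.sqrt 2 - 5) ⊆ ball 0 1 := fun z hz => by
    rw [mem_ball_zero_iff] at hz ⊢; exact radius_lt_one hz
  have hn := norm_circle hr0.le
  have hne := circle_ne_zero hr0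
  -- The inequality |g| < |h| excludes zeros of h off the origin, so h/z has a logarithm. It also
  -- makes |conj g / h| < 1, so f = h(1 + conj g / h) has one along the circle.
  obtain ⟨L, hL, hLe⟩ := exists_log_of_ne_zero starlike_radius_pos
    (differentiableOn_dslope_ball starlike_radius_pos (H.hd.mono hR)) (fun z hz => by
      rcases eq_or_ne z 0 with rfl | hz0
      · rw [dslope_same, H.deriv_h_zero]; exact one_ne_zero
      · intro h0
        have := (H.harmonic_pos hz0 (by simpa using hz)).1
        rw [eq_mul_dslope H.h_zero z, h0, mul_zero, norm_zero] at this
        exact absurd this (not_lt.2 (norm_nonneg _)))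
  have hpos := fun t => H.harmonic_pos (hne t) ((hn t).trans_lt hr)
  have hh0 : ∀ t : ℝ, h (r * Complex.exp (t * Complex.I)) ≠ 0 := fun t h0 => by
    have := (hpos t).1
    rw [h0, norm_zero] at this
    exact absurd this (not_lt.2 (norm_nonneg _))
  obtain ⟨Φ, hΦ, hΦe, hΦper⟩ := exists_log_circle (M := L)
    (w := fun t => conj (g (r * Complex.exp (t * Complex.I))) / h (r * Complex.exp (t * Complex.I)))
    0 hr0
    (fun z hz => hL.differentiableAt (isOpen_ball.mem_nhds (by simpa [hz] using hr)))
    (fun t => by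
      have hc := hasDerivAt_circle r t
      have hlt := (hn t).trans_lt hr1
      exact ((hasDerivAt_conj (HasDerivAt.comp t (H.hasDerivAt_g hlt) hc)).div
        (HasDerivAt.comp t (H.hasDerivAt_h hlt) hc) (hh0 t)).differentiableAt)
    (fun t => by
      rw [norm_div, Complex.norm_conj, div_lt_one (norm_pos_iff.2 (hh0 t))]
      exact (hpos t).1)
    (fun t n => by simp only [circle_add_int_mul])
  have hfc : ∀ t : ℝ, imageOfCircle f r t = h (r * Complex.exp (t * Complex.I)) +
      conj (g (r * Complex.exp (t * Complex.I))) := fun t =>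
    hf _ (by rw [mem_ball_zero_iff, hn]; exact hr1)
  have hγ : ∀ t, imageOfCircle f r t = Complex.exp (Φ t) := fun t => by
    rw [← hΦe, hfc, ← hLe _ (by rw [mem_ball_zero_iff, hn]; exact hr), Complex.exp_zero, one_mul,
      ← eq_mul_dslope H.h_zero]
    have := hh0 t
    field_simp
  have him : ∀ t, 0 < (deriv (imageOfCircle f r) t * conj (imageOfCircle f r t)).im := fun t => by
    rw [(H.hasDerivAt_imageOfCircle hf hr0.le hr1 t).deriv, im_mul_conj_I_mul, hfc]
    exact (hpos t).2
  have h00 : (0 : ℂ) ∈ f '' ball 0 r := ⟨0, by simpa using hr0, by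
    rw [hf 0 (by simp), H.h_zero, H.g_zero]; simp⟩
  exact ⟨⟨H.isOpen_image hf hr1, h00, starConvex_of_frontier_subset (H.isOpen_image hf hr1)
    (H.closure_image_subset hf hr1).2 h00 hγ (strictMono_im_of_exp hΦ hγ him) hΦper
    (periodic_imageOfCircle f r) (H.frontier_image_subset hf hr1)⟩,
    argDerivPos_of_exp hΦ hγ him⟩

theorem convex_of_lt (H : IsPair α h g)
    (hf : ∀ z ∈ ball (0 : ℂ) 1, f z = h z + conj (g z)) {r : ℝ} (hr0 : 0 < r)
    (hr : r < 2 - Real.sqrt 3) :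
    IsConvexDomain (f '' ball 0 r) ∧ ArgDerivPos (deriv (imageOfCircle f r)) := by
  have hr1 := radius_lt_one (hr.trans_le convex_radius_le_starlike_radius)
  have hn := norm_circle hr0.le
  have hne := circle_ne_zero hr0
  have hb : ∀ t : ℝ, (r * Complex.exp (t * Complex.I) : ℂ) ∈ ball (0 : ℂ) 1 := fun t => by
    rw [mem_ball_zero_iff, hn]; exact hr1
  obtain ⟨L, hL, hLe⟩ := exists_log_of_ne_zero one_pos (H.hd.deriv isOpen_ball) H.deriv_h_ne
  have hF0 : ∀ t : ℝ, (r * Complex.exp (t * Complex.I) : ℂ) *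
      deriv h (r * Complex.exp (t * Complex.I)) ≠ 0 := fun t =>
    mul_ne_zero (hne t) (H.deriv_h_ne _ (hb t))
  have hα : ∀ t : ℝ, ‖α * (r * Complex.exp (t * Complex.I) : ℂ)‖ ≤ r := fun t => by
    rw [norm_mul, hn]; nlinarith [H.alpha]
  obtain ⟨Φ, hΦ, hΦe, hΦper⟩ := exists_log_circle (M := L)
    (w := fun t => -(conj (α * (r * Complex.exp (t * Complex.I)) * (r * Complex.exp (t * Complex.I) *
      deriv h (r * Complex.exp (t * Complex.I)))) / (r * Complex.exp (t * Complex.I) *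
      deriv h (r * Complex.exp (t * Complex.I)))))
    -- This constant supplies the factor i of the θ-derivative i(zh' - conj(αz · zh')).
    (Real.pi / 2 * Complex.I) hr0
    (fun z hz => hL.differentiableAt (isOpen_ball.mem_nhds (by simpa [hz] using hr1)))
    (fun t => by
      have hc := hasDerivAt_circle r t
      have h1 := hc.mul (HasDerivAt.comp t
        (H.hasDerivAt_deriv_h (mem_ball_zero_iff.1 (hb t))) hc)
      exact ((hasDerivAt_conj ((hc.const_mul α).mul h1)).div h1 (hF0 t)).neg.differentiableAt)
    (fun t => by
      rw [norm_neg, norm_div, Complex.norm_conj, norm_mul,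
        mul_div_cancel_right₀ _ (norm_ne_zero_iff.2 (hF0 t))]
      exact (hα t).trans_lt hr1)
    (fun t n => by simp only [circle_add_int_mul])
  have hd := H.hasDerivAt_imageOfCircle hf hr0.le hr1
  have hγ : ∀ t, deriv (imageOfCircle f r) t = Complex.exp (Φ t) := fun t => by
    rw [← hΦe, (hd t).deriv, ← hLe _ (hb t), Complex.exp_pi_div_two_mul_I]
    have := hF0 t
    generalize deriv h (r * Complex.exp (t * Complex.I)) = p at *
    generalize (r * Complex.exp (t * Complex.I) : ℂ) = z at *
    rw [mul_assoc Complex.I, mul_assoc Complex.I, mul_add, mul_one, mul_neg,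
      mul_div_cancel₀ _ this, sub_eq_add_neg]
  have him : ∀ t, 0 < (deriv (deriv (imageOfCircle f r)) t *
      conj (deriv (imageOfCircle f r) t)).im := fun t => by
    rw [(H.hasDerivAt_deriv_imageOfCircle hf hr0 hr1 t rfl rfl rfl).deriv, (hd t).deriv]
    have key := convex_numerator_pos (hF0 t) hr0.le hr (hα t) (by
      have := H.re_one_add_ge (mem_ball_zero_iff.1 (hb t))
      rwa [hn] at this)
    rwa [im_neg_mul_conj_I_mul]
  have hmono := strictMono_im_of_exp hΦ hγ him
  exact ⟨⟨H.isOpen_image hf hr1, ⟨f 0, 0, by simpa using hr0, rfl⟩,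
    convex_of_frontier_subset (H.isOpen_image hf hr1) (H.closure_image_subset hf hr1).2
      (H.frontier_image_subset hf hr1) fun t₀ =>
        ⟨_, mul_ne_zero (Complex.exp_ne_zero _) Complex.I_ne_zero,
          re_le_of_tangent (fun t => (hd t).differentiableAt.hasDerivAt) hΦ.continuous hγ hmono
            hΦper (periodic_imageOfCircle f r) t₀⟩⟩,
    argDerivPos_of_exp hΦ hγ him⟩

end IsPair

theorem isPair_of_mem_classM {α : ℂ} (hα : ‖α‖ ≤ 1) {f : ℂ → ℂ} (hf : f ∈ classM α) :
    ∃ h g : ℂ → ℂ, IsPair α h g ∧ ∀ z ∈ ball (0 : ℂ) 1, f z = h z + conj (g z) := by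
  obtain ⟨h, g, hh, hg, h0, g0, h1, hfe, hgd, hc⟩ := hf
  refine ⟨h, g, ⟨hα, hh, hg, h0, g0, h1, hgd, fun z hz => (hc z hz).1, fun z hz => ?_⟩, hfe⟩
  have := (hc z hz).2
  rw [Complex.add_re, Complex.one_re] at this
  linarith

theorem theorem3p5 (α : ℂ) (hα : ‖α‖ ≤ 1) (f : ℂ → ℂ) (hf : f ∈ classM α) :
    (IsConvexDomain (f '' ball 0 (2 - Real.sqrt 3)) ∧ FullyConvex f (2 - Real.sqrt 3)) ∧
    (IsStarlikeDomain (f '' ball 0 (4 * Real.sqrt 2 - 5)) ∧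
      FullyStarlike f (4 * Real.sqrt 2 - 5)) := by
  obtain ⟨h, g, H, hfe⟩ := isPair_of_mem_classM hα hf
  have hconv : ∀ r : ℝ, 0 < r → r < 2 - Real.sqrt 3 → _ := fun r h1 h2 => H.convex_of_lt hfe h1 h2
  have hstar : ∀ r : ℝ, 0 < r → r < 4 * Real.sqrt 2 - 5 → _ :=
    fun r h1 h2 => H.starlike_of_lt hfe h1 h2
  have hs1 : 4 * Real.sqrt 2 - 5 < 1 := by
    have : Real.sqrt 2 < 3 / 2 := by
      rw [Real.sqrt_lt' (by norm_num)]; norm_num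
    linarith
  refine ⟨⟨⟨H.isOpen_image hfe (convex_radius_le_starlike_radius.trans_lt hs1),
    ⟨f 0, 0, mem_ball_self convex_radius_pos, rfl⟩, ?_⟩,
    H.univalentSensePreserving hfe convex_radius_le_starlike_radius, hconv⟩,
    ⟨H.isOpen_image hfe hs1, ⟨0, mem_ball_self starlike_radius_pos, by
      rw [hfe 0 (by simp), H.h_zero, H.g_zero]; simp⟩, ?_⟩,
    H.univalentSensePreserving hfe le_rfl, hstar⟩
  -- The estimates hold for r strictly below the radius; a smaller disk containing both points
  -- suffices.
  · rintro _ ⟨x, hx, rfl⟩ _ ⟨y, hy, rfl⟩ a b ha hb hab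
    obtain ⟨r, hr1, hr2⟩ := exists_between
      (max_lt convex_radius_pos (max_lt (mem_ball_zero_iff.1 hx) (mem_ball_zero_iff.1 hy)))
    obtain ⟨hr0, hxy⟩ := max_lt_iff.1 hr1
    obtain ⟨hxr, hyr⟩ := max_lt_iff.1 hxy
    exact image_mono (ball_subset_ball hr2.le) ((hconv r hr0 hr2).1.2.2
      (mem_image_of_mem f (mem_ball_zero_iff.2 hxr))
      (mem_image_of_mem f (mem_ball_zero_iff.2 hyr)) ha hb hab)
  · rintro _ ⟨x, hx, rfl⟩ a b ha hb hab
    obtain ⟨r, hr1, hr2⟩ := exists_between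
      (max_lt starlike_radius_pos (mem_ball_zero_iff.1 hx))
    obtain ⟨hr0, hxr⟩ := max_lt_iff.1 hr1
    exact image_mono (ball_subset_ball hr2.le) ((hstar r hr0 hr2).1.2.2
      (mem_image_of_mem f (mem_ball_zero_iff.2 hxr)) ha hb hab)
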